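/- All graphs are finite and simple. A graph $H$ is a minor of a graph $G$ if $H$ is isomorphic to a graph obtained from a subgraph of $G$ by contracting edges (loops and parallel edges being discarded). $K_{n_1,\dots,n_k}$ denotes the complete multipartite graph with parts of sizes $n_1,\dots,n_k$, $K_{4,4}^-$ denotes the graph obtained from $K_{4,4}$ by deleting one edge, and $K_6^{\Delta Y}$ denotes the graph obtained from the complete graph $K_6$ by deleting the three edges of a triangle and adding a new vertex adjacent to exactly the three vertices of that triangle. **Theorem.** Let $G$ be a bipartite graph on $n \ge 5$ vertices with no minor isomorphic to $K_6$, $K_{1,3,3}$, $K_{4,4}^-$ or $K_6^{\Delta Y}$. If $G$ is not isomorphic to $K_{3,n-3}$, then $G$ has at most $3n-10$ edges. -/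

import Mathlib

namespace BipartiteMinors

/-- The simple graph `G / F` obtained from `G` by contracting the edges of the graph `F` (used for
`F ≤ G`, so that `F` is just a set of edges of `G`). Its vertices are the connected components
of `F`; two distinct ones are adjacent iff some edge of `G` joins them. Loops and
parallel edges are discarded. -/
def contract {V : Type*} (G F : SimpleGraph V) : SimpleGraph F.ConnectedComponent where
  Adj c d := c ≠ d ∧ ∃ u v : V,
    F.connectedComponentMk u = c ∧ F.connectedComponentMk v = d ∧ G.Adj u v
  symm := ⟨fun _ _ ⟨hne, u, v, hu, hv, h⟩ => ⟨hne.symm, v, u, hv, hu, h.symm⟩⟩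
  loopless := ⟨fun _ h => h.1 rfl⟩

/-- `G` has an `H` minor: `H` is isomorphic to a graph obtained from a subgraph `S` of `G` by
contracting edges of `S`. -/
def HasMinor {V W : Type*} (G : SimpleGraph V) (H : SimpleGraph W) : Prop :=
  ∃ (S : G.Subgraph) (F : SimpleGraph S.verts), F ≤ S.coe ∧ Nonempty (H ≃g contract S.coe F)

/-- The `ΔY` transformation of `G` at the triangle `a b c`: the three edges of the triangle are
deleted, and a new vertex `none` is added that is joined exactly to `a`, `b` and `c`. -/
def deltaY {V : Type*} (G : SimpleGraph V) (a b c : V) : SimpleGraph (Option V) :=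
  (G.deleteEdges {s(a, b), s(b, c), s(a, c)}).map some ⊔
    SimpleGraph.fromEdgeSet {s(none, some a), s(none, some b), s(none, some c)}

/-- `K₆`. -/
def K6 : SimpleGraph (Fin 6) := ⊤

/-- `K_{1,3,3}`. -/
def K133 : SimpleGraph (Σ i : Fin 3, Fin (![1, 3, 3] i)) :=
  SimpleGraph.completeMultipartiteGraph fun i : Fin 3 => Fin (![1, 3, 3] i)

/-- `K_{4,4}` with one edge deleted. -/
def K44Minus : SimpleGraph (Fin 4 ⊕ Fin 4) :=
  (completeBipartiteGraph (Fin 4) (Fin 4)).deleteEdges {s(Sum.inl 0, Sum.inr 0)}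

/-- The graph obtained from `K₆` by a `ΔY` transformation. -/
def K6DeltaY : SimpleGraph (Option (Fin 6)) := deltaY K6 0 1 2

end BipartiteMinors

/-! Fix a proper colouring with two colours. A class of size three allows at most 3(n-3) = 3n-9
edges, attained only by $K_{3,n-3}$, and smaller classes are settled by counting. What remains is
the case where both classes have at least four vertices; there the bound is proved by induction on
n. A minimal counterexample can be taken with exactly 3n-9 edges. All smaller minors coloured by
representatives, with both classes still of size at least four, obey the bound, and the
contradictions are minors $K_{4,4}^-$ and $K_6$.

Induction first gives minimum degree four. Contracting a path a v b gives deg v + |N(a) ∩ N(b)| ≥ 8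
(`eight_le`). Contracting one side of a separation into the other shows that small sets of
prescribed colours do not separate the graph (`no_edge_cut`, `no_cut`).

A vertex v of degree four is one row of a potential $K_{4,4}^-$ whose columns are its neighbours. If
another vertex shares three of these neighbours, it serves as a second row. The rest of the graph
has no cut vertex, up to some leaves, so it can be grown vertex by vertex and split into two
connected rows (`exists_growth`). Hence no vertex shares three neighbours with v
(`card_inter_le_two`). Around a vertex of degree five, Hall's theorem distributes other vertices
among its neighbours so that the resulting stars form a $K_6$ (`degree_ne_five`).

Thus every degree is four or at least six. A vertex with f > 0 neighbours of degree four has degree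
at least 6 + f/2 (`card_smallNb`), so sending 1/2 to each neighbour of degree four leaves every
vertex with charge at least six. The degree sum, however, is 6n-18. -/

namespace BipartiteMinors

open Finset

/-! ### Connected vertex sets, leaves and growth without cut vertices -/

section Connectivity

variable {V : Type*} (G : SimpleGraph V)

/-- A finite vertex set is preconnected if no proper nonempty subset is closed under adjacency. -/
def Preconn (s : Finset V) : Prop :=
  ∀ P ⊆ s, P.Nonempty → (∀ x ∈ P, ∀ y ∈ s, G.Adj x y → y ∈ P) → P = s

/-- A finite vertex set inducing a connected subgraph. -/
def Conn (s : Finset V) : Prop := s.Nonempty ∧ Preconn G s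

/-- Some vertex of `X` is adjacent to `l`. -/
def Touches (X : Finset V) (l : V) : Prop := ∃ x ∈ X, G.Adj x l

variable {G}

theorem Touches.mono {X Y : Finset V} {l : V} (h : Touches G X l) (hXY : X ⊆ Y) :
    Touches G Y l :=
  let ⟨x, hx, hl⟩ := h; ⟨x, hXY hx, hl⟩

theorem conn_singleton (x : V) : Conn G {x} := by
  refine ⟨singleton_nonempty x, fun P hP hne _ => ?_⟩
  rcases subset_singleton_iff.1 hP with h | h
  · simp [h] at hne
  · exact h

variable [DecidableEq V]

theorem Conn.union_leaves {s W : Finset V} (hs : Conn G s)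
    (hW : ∀ w ∈ W, ∃ x ∈ s, G.Adj x w) : Conn G (s ∪ W) := by
  refine ⟨hs.1.mono subset_union_left, fun P hP hne hcl => ?_⟩
  have hPs : (P ∩ s).Nonempty := by
    obtain ⟨p, hp⟩ := hne
    rcases mem_union.1 (hP hp) with h | h
    · exact ⟨p, mem_inter.2 ⟨hp, h⟩⟩
    · obtain ⟨x, hx, hxp⟩ := hW p h
      exact ⟨x, mem_inter.2 ⟨hcl p hp x (mem_union_left _ hx) hxp.symm, hx⟩⟩
  have hsP : s ⊆ P := by
    have := hs.2 (P ∩ s) inter_subset_right hPs fun x hx y hy hxy =>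
      mem_inter.2 ⟨hcl x (mem_inter.1 hx).1 y (mem_union_left _ hy) hxy, hy⟩
    exact fun y hy => (mem_inter.1 (this ▸ hy)).1
  refine hP.antisymm fun y hy => ?_
  rcases mem_union.1 hy with h | h
  · exact hsP h
  · obtain ⟨x, hx, hxy⟩ := hW y h
    exact hcl x (hsP hx) y hy hxy

theorem conn_insert_star {a : V} {W : Finset V} (hW : ∀ w ∈ W, G.Adj a w) :
    Conn G (insert a W) := by
  have := (conn_singleton (G := G) a).union_leaves (W := W)
    fun w hw => ⟨a, mem_singleton_self a, hW w hw⟩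
  rwa [← insert_eq] at this

theorem Conn.insert {s : Finset V} {t : V} (hs : Conn G s) (h : ∃ x ∈ s, G.Adj x t) :
    Conn G (insert t s) := by
  have := hs.union_leaves (W := {t}) (by simpa using h)
  rwa [union_comm, ← insert_eq] at this

theorem Conn.union {s t : Finset V} (hs : Conn G s) (ht : Conn G t)
    (h : ∃ x ∈ s, ∃ y ∈ t, G.Adj x y) : Conn G (s ∪ t) := by
  refine ⟨hs.1.mono subset_union_left, fun P hP hne hcl => ?_⟩
  have key : ∀ u : Finset V, Conn G u → u ⊆ s ∪ t → (P ∩ u).Nonempty → u ⊆ P := by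
    intro u hu hut hne
    have := hu.2 (P ∩ u) inter_subset_right hne fun x hx y hy hxy =>
      mem_inter.2 ⟨hcl x (mem_inter.1 hx).1 y (hut hy) hxy, hy⟩
    exact fun y hy => (mem_inter.1 (this ▸ hy)).1
  obtain ⟨x, hx, y, hy, hxy⟩ := h
  have hboth : s ⊆ P ∧ t ⊆ P := by
    obtain ⟨p, hp⟩ := hne
    rcases mem_union.1 (hP hp) with h | h
    · have hs' := key s hs subset_union_left ⟨p, mem_inter.2 ⟨hp, h⟩⟩
      exact ⟨hs', key t ht subset_union_right
        ⟨y, mem_inter.2 ⟨hcl x (hs' hx) y (mem_union_right _ hy) hxy, hy⟩⟩⟩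
    · have ht' := key t ht subset_union_right ⟨p, mem_inter.2 ⟨hp, h⟩⟩
      exact ⟨key s hs subset_union_left
        ⟨x, mem_inter.2 ⟨hcl y (ht' hy) x (mem_union_left _ hx) hxy.symm, hx⟩⟩, ht'⟩
  exact hP.antisymm (union_subset hboth.1 hboth.2)

/-- A connected subset closed under adjacency inside every closed subset. -/
theorem exists_conn_closed (s : Finset V) : ∀ P : Finset V, P ⊆ s → P.Nonempty →
    (∀ x ∈ P, ∀ y ∈ s, G.Adj x y → y ∈ P) →
    ∀ x₀ ∈ P, ∃ K ⊆ P, x₀ ∈ K ∧ Conn G K ∧ ∀ x ∈ K, ∀ y ∈ s, G.Adj x y → y ∈ K := by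
  intro P
  induction P using Finset.strongInduction with
  | H P ih =>
    intro hP hne hcl x₀ hx₀
    by_cases hc : Preconn G P
    · exact ⟨P, Subset.rfl, hx₀, ⟨hne, hc⟩, hcl⟩
    · simp only [Preconn, not_forall] at hc
      obtain ⟨Q, hQP, hQne, hQcl, hQ⟩ := hc
      have hQcl' : ∀ x ∈ Q, ∀ y ∈ s, G.Adj x y → y ∈ Q := fun x hx y hy hxy =>
        hQcl x hx y (hcl x (hQP hx) y hy hxy) hxy
      by_cases hx : x₀ ∈ Q
      · obtain ⟨K, hKQ, h⟩ := ih Q (hQP.ssubset_of_ne hQ) (hQP.trans hP) hQne hQcl' x₀ hx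
        exact ⟨K, hKQ.trans hQP, h⟩
      · have hsd : P \ Q ⊂ P := sdiff_ssubset hQP hQne
        obtain ⟨K, hKQ, h⟩ := ih (P \ Q) hsd (hsd.1.trans hP) ⟨x₀, by simp [hx, hx₀]⟩
          (fun x hx y hy hxy => mem_sdiff.2 ⟨hcl x (mem_sdiff.1 hx).1 y hy hxy, fun hyQ =>
            (mem_sdiff.1 hx).2 (hQcl' y hyQ x (hP (mem_sdiff.1 hx).1) hxy.symm)⟩) x₀
          (by simp [hx, hx₀])
        exact ⟨K, hKQ.trans hsd.1, h⟩

/-- The component of a vertex inside a finite set. -/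
theorem exists_component (s : Finset V) {x₀ : V} (hx₀ : x₀ ∈ s) :
    ∃ K ⊆ s, x₀ ∈ K ∧ Conn G K ∧ ∀ x ∈ K, ∀ y ∈ s, G.Adj x y → y ∈ K :=
  exists_conn_closed s s Subset.rfl ⟨x₀, hx₀⟩ (fun _ _ _ hy _ => hy) x₀ hx₀

/-- A set that is not preconnected contains two disjoint components. -/
theorem exists_two_components {s : Finset V} (h : ¬ Preconn G s) :
    ∃ K L : Finset V, K ⊆ s ∧ L ⊆ s ∧ Disjoint K L ∧ Conn G K ∧ Conn G L ∧
      (∀ x ∈ K, ∀ y ∈ s, G.Adj x y → y ∈ K) ∧ (∀ x ∈ L, ∀ y ∈ s, G.Adj x y → y ∈ L) := by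
  simp only [Preconn, not_forall] at h
  obtain ⟨P, hPs, ⟨p, hp⟩, hcl, hne⟩ := h
  obtain ⟨q, hq⟩ : (s \ P).Nonempty := by
    rw [sdiff_nonempty]
    exact fun h => hne (hPs.antisymm h)
  obtain ⟨K, hK, -, hKc, hKcl⟩ := exists_conn_closed s P hPs ⟨p, hp⟩ hcl p hp
  obtain ⟨L, hL, -, hLc, hLcl⟩ := exists_conn_closed s (s \ P) sdiff_subset ⟨q, hq⟩
    (fun x hx y hy hxy => mem_sdiff.2 ⟨hy, fun hyP =>
      (mem_sdiff.1 hx).2 (hcl y hyP x (mem_sdiff.1 hx).1 hxy.symm)⟩) q hq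
  exact ⟨K, L, hK.trans hPs, hL.trans sdiff_subset,
    disjoint_of_subset_left hK (disjoint_of_subset_right hL disjoint_sdiff), hKc, hLc, hKcl, hLcl⟩

/-- Deleting an independent set of vertices of degree at most one keeps a set preconnected. -/
theorem Preconn.sdiff_leaves {s W : Finset V} (hs : Preconn G s)
    (hW : ∀ w ∈ W, w ∈ s → ∀ x ∈ s, ∀ y ∈ s, G.Adj w x → G.Adj w y → x = y) :
    Preconn G (s \ W) := by
  classical
  intro P hP hne hcl
  -- `P` together with the deleted leaves hanging at it is closed in `s`, hence all of `s`.
  have hQ := hs (P ∪ (s ∩ W).filter fun w => ∃ x ∈ P, G.Adj x w)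
    (union_subset (hP.trans sdiff_subset) ((filter_subset _ _).trans inter_subset_left))
    (hne.mono subset_union_left) ?_
  · refine hP.antisymm fun y hy => ?_
    rw [mem_sdiff] at hy
    have : y ∈ P ∪ (s ∩ W).filter fun w => ∃ x ∈ P, G.Adj x w := by
      rw [hQ]; exact hy.1
    rcases mem_union.1 this with h | h
    · exact h
    · exact absurd (mem_inter.1 (mem_filter.1 h).1).2 hy.2
  · intro x hx y hy hxy
    rcases mem_union.1 hx with h | h
    · by_cases hyW : y ∈ W
      · exact mem_union_right _ (mem_filter.2 ⟨mem_inter.2 ⟨hy, hyW⟩, x, h, hxy⟩)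
      · exact mem_union_left _ (hcl x h y (mem_sdiff.2 ⟨hy, hyW⟩) hxy)
    · obtain ⟨hxW, z, hz, hzx⟩ := mem_filter.1 h
      rw [mem_inter] at hxW
      have := hW x hxW.2 hxW.1 y hy z (mem_sdiff.1 (hP hz)).1 hxy hzx.symm
      exact mem_union_left _ (this ▸ hz)

/-- In a set that no single vertex disconnects, a part with preconnected complement can be
extended by a vertex. -/
theorem exists_extension {R : Finset V} (hR : Preconn G R)
    (hR1 : ∀ t ∈ R, Preconn G (R.erase t)) {P : Finset V} (hPR : P ⊆ R) (hP : P.Nonempty)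
    (hc : Preconn G (R \ P)) (hne : (R \ P).Nonempty) :
    ∃ t ∈ R \ P, (∃ x ∈ P, G.Adj x t) ∧ Preconn G ((R \ P).erase t) := by
  -- Descent: suppose every vertex of `R \ P` with a neighbour in `P` disconnects `R \ P`. A piece
  -- `K` split off by such a `t` contains another such vertex `u`, because `t` alone does not
  -- disconnect `R`. The piece split off by `u` that avoids `t` lies in `K` and misses `u`, so it is
  -- smaller.
  by_contra hcon
  push Not at hcon
  -- a component of the rest of a cut vertex contains a further cut vertex
  have key : ∀ n : ℕ, ∀ K : Finset V, K.card ≤ n → ∀ t ∈ R \ P, (∃ x ∈ P, G.Adj x t) →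
      K ⊆ (R \ P).erase t → K.Nonempty → K ≠ (R \ P).erase t →
      (∀ x ∈ K, ∀ y ∈ (R \ P).erase t, G.Adj x y → y ∈ K) → False := by
    intro n
    induction n with
    | zero =>
      intro K hK t _ _ _ hne
      exact absurd (card_pos.2 hne) (by omega)
    | succ n ih =>
      intro K hK t ht htP hKs hKne hKneq hKcl
      have htR : t ∈ R := (mem_sdiff.1 ht).1
      have hKR : K ⊆ R.erase t := fun x hx => by
        have := hKs hx
        simp only [mem_erase, mem_sdiff] at this ⊢
        exact ⟨this.1, this.2.1⟩
      -- K has a vertex with a neighbour in P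
      obtain ⟨u, huK, huP⟩ : ∃ u ∈ K, ∃ x ∈ P, G.Adj x u := by
        by_contra hno
        push Not at hno
        have := hR1 t htR K hKR hKne fun x hx y hy hxy => by
          by_cases hyP : y ∈ P
          · exact absurd hxy.symm (hno x hx y hyP)
          · exact hKcl x hx y (by simp only [mem_erase, mem_sdiff] at hy ⊢; tauto) hxy
        obtain ⟨p, hp⟩ := hP
        have hpt : p ≠ t := fun h => (mem_sdiff.1 ht).2 (h ▸ hp)
        have hpK : p ∈ K := this ▸ mem_erase.2 ⟨hpt, hPR hp⟩
        have := hKs hpK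
        simp only [mem_erase, mem_sdiff] at this
        exact this.2.2 hp
      have huRP : u ∈ R \ P := (mem_erase.1 (hKs huK)).2
      have hut : u ≠ t := (mem_erase.1 (hKs huK)).1
      have hnu := hcon u huRP huP
      simp only [Preconn, not_forall] at hnu
      obtain ⟨Q, hQs, hQne, hQcl, hQneq⟩ := hnu
      -- the closed part avoiding t
      obtain ⟨Q', hQ's, hQ'ne, hQ'cl, hQ't⟩ : ∃ Q' ⊆ (R \ P).erase u, Q'.Nonempty ∧
          (∀ x ∈ Q', ∀ y ∈ (R \ P).erase u, G.Adj x y → y ∈ Q') ∧ t ∉ Q' := by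
        by_cases htQ : t ∈ Q
        · refine ⟨(R \ P).erase u \ Q, sdiff_subset, ?_, ?_, fun h => (mem_sdiff.1 h).2 htQ⟩
          · rw [sdiff_nonempty]
            exact fun h => hQneq (hQs.antisymm h)
          · exact fun x hx y hy hxy => mem_sdiff.2 ⟨hy, fun hyQ =>
              (mem_sdiff.1 hx).2 (hQcl y hyQ x (mem_sdiff.1 hx).1 hxy.symm)⟩
        · exact ⟨Q, hQs, hQne, hQcl, htQ⟩
      -- Q' lies in K
      have hQ'K : Q' ⊆ K := by
        by_contra hnot
        obtain ⟨q, hq, hqK⟩ := not_subset.1 hnot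
        have := hc (Q' \ K) (fun x hx => (mem_erase.1 (hQ's (mem_sdiff.1 hx).1)).2)
          ⟨q, mem_sdiff.2 ⟨hq, hqK⟩⟩ fun x hx y hy hxy => by
            rw [mem_sdiff] at hx
            have hxt : x ≠ t := fun h => hQ't (h ▸ hx.1)
            have hxRP := (mem_erase.1 (hQ's hx.1)).2
            have hyK : y ∉ K := fun hyK =>
              hx.2 (hKcl y hyK x (mem_erase.2 ⟨hxt, hxRP⟩) hxy.symm)
            have hyu : y ≠ u := fun h => hyK (h ▸ huK)
            exact mem_sdiff.2 ⟨hQ'cl x hx.1 y (mem_erase.2 ⟨hyu, hy⟩) hxy, hyK⟩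
        exact hQ't (mem_sdiff.1 (this ▸ ht)).1
      have huQ' : u ∉ Q' := fun h => (mem_erase.1 (hQ's h)).1 rfl
      refine ih Q' ?_ u huRP huP hQ's hQ'ne (fun h => hQ't (h ▸ mem_erase.2 ⟨hut.symm, ht⟩)) hQ'cl
      have : Q' ⊂ K := hQ'K.ssubset_of_ne fun h => huQ' (h ▸ huK)
      have := card_lt_card this
      omega
  obtain ⟨t, ht, htP⟩ : ∃ t ∈ R \ P, ∃ x ∈ P, G.Adj x t := by
    by_contra hno
    push Not at hno
    have := hR P hPR hP fun x hx y hy hxy => by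
      by_contra hyP
      exact hno y (mem_sdiff.2 ⟨hy, hyP⟩) x hx hxy
    exact hne.ne_empty (by rw [this]; simp)
  have hn := hcon t ht htP
  simp only [Preconn, not_forall] at hn
  obtain ⟨K, hKs, hKne, hKcl, hKneq⟩ := hn
  exact key _ K le_rfl t ht htP hKs hKne hKneq hKcl

/-- Growing a connected set with preconnected complement until a given property holds. -/
theorem exists_growth {R : Finset V} (hR : Preconn G R)
    (hR1 : ∀ t ∈ R, Preconn G (R.erase t)) (φ : Finset V → Prop) (h0 : ¬ φ ∅) (h1 : φ R) :
    ∃ P ⊆ R, ∃ t ∈ R, t ∉ P ∧ Conn G (insert t P) ∧ Preconn G ((R \ P).erase t) ∧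
      ¬ φ P ∧ φ (insert t P) := by
  classical
  -- Take a largest `P` violating `φ` such that `P` and its complement are both preconnected; the
  -- empty set is a candidate because it counts as preconnected. Extending `P` by one vertex must
  -- then make `φ` true.
  have hex : ∃ P ∈ R.powerset.filter
      (fun P => Preconn G P ∧ Preconn G (R \ P) ∧ ¬ φ P), ∀ Q ∈ R.powerset.filter
      (fun P => Preconn G P ∧ Preconn G (R \ P) ∧ ¬ φ P), Q.card ≤ P.card := by
    refine exists_max_image _ _ ⟨∅, ?_⟩
    simp only [mem_filter, mem_powerset, empty_subset, true_and, sdiff_empty]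
    exact ⟨fun P hP hne => absurd hne (by simp [subset_empty.1 hP]), hR, h0⟩
  obtain ⟨P, hP, hmax⟩ := hex
  simp only [mem_filter, mem_powerset] at hP hmax
  obtain ⟨hPR, hPc, hPc', hPφ⟩ := hP
  have hne : (R \ P).Nonempty := by
    rw [sdiff_nonempty]
    exact fun h => hPφ (hPR.antisymm h ▸ h1)
  obtain ⟨t, ht, hconn, hpre⟩ : ∃ t ∈ R \ P, Conn G (insert t P) ∧
      Preconn G ((R \ P).erase t) := by
    rcases P.eq_empty_or_nonempty with rfl | hPne
    · obtain ⟨t, ht⟩ := hne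
      refine ⟨t, ht, by simpa using conn_singleton t, ?_⟩
      simp only [sdiff_empty] at ht ⊢
      exact hR1 t ht
    · obtain ⟨t, ht, h, h'⟩ := exists_extension hR hR1 hPR hPne hPc' hne
      exact ⟨t, ht, Conn.insert ⟨hPne, hPc⟩ h, h'⟩
  rw [mem_sdiff] at ht
  refine ⟨P, hPR, t, ht.1, ht.2, hconn, hpre, hPφ, ?_⟩
  by_contra hφ
  have h2 : R \ insert t P = (R \ P).erase t := by
    ext z; simp only [mem_sdiff, mem_insert, mem_erase]; tauto
  have := hmax (insert t P) ⟨insert_subset ht.1 hPR, hconn.2, by rwa [h2], hφ⟩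
  rw [card_insert_of_notMem ht.2] at this
  omega

end Connectivity

end BipartiteMinors

namespace BipartiteMinors

open Finset

/-! ### Minor models by branch sets -/

section Models

variable {V W : Type*} {G : SimpleGraph V}

/-- A model of `H` in `G`: disjoint connected branch sets joined by edges as prescribed by `H`. -/
def Model (G : SimpleGraph V) (H : SimpleGraph W) : Prop :=
  ∃ φ : W → Finset V, (∀ i, Conn G (φ i)) ∧ (∀ i j, i ≠ j → Disjoint (φ i) (φ j)) ∧
    ∀ i j, H.Adj i j → ∃ x ∈ φ i, ∃ y ∈ φ j, G.Adj x y

/-- The subgraph keeps only edges inside a branch set or between branch sets of `H`-adjacent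
indices. Contracting the branch sets therefore gives `H` itself and not a graph with extra edges. -/
theorem Model.hasMinor {H : SimpleGraph W} (h : Model G H) : HasMinor G H := by
  classical
  obtain ⟨φ, hc, hd, hadj⟩ := h
  let S : G.Subgraph :=
    { verts := {x | ∃ i, x ∈ φ i}
      Adj := fun x y => G.Adj x y ∧ ∃ i j, x ∈ φ i ∧ y ∈ φ j ∧ (i = j ∨ H.Adj i j)
      adj_sub := fun h => h.1
      edge_vert := fun ⟨_, i, _, hi, _⟩ => ⟨i, hi⟩
      symm := ⟨fun _ _ ⟨h, i, j, hi, hj, hij⟩ =>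
        ⟨h.symm, j, i, hj, hi, hij.imp Eq.symm fun h => h.symm⟩⟩ }
  let F : SimpleGraph S.verts :=
    { Adj := fun x y => G.Adj x y ∧ ∃ i, (x : V) ∈ φ i ∧ (y : V) ∈ φ i
      symm := ⟨fun _ _ ⟨h, i, hi, hj⟩ => ⟨h.symm, i, hj, hi⟩⟩
      loopless := ⟨fun x h => G.loopless.1 x h.1⟩ }
  have huniq : ∀ {x : V} {i j : W}, x ∈ φ i → x ∈ φ j → i = j := fun {x i j} hi hj => by
    by_contra hij
    exact disjoint_left.1 (hd i j hij) hi hj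
  have hreach1 : ∀ {x y : S.verts}, F.Reachable x y → ∀ i, (x : V) ∈ φ i → (y : V) ∈ φ i := by
    rintro x y ⟨p⟩
    induction p with
    | nil => exact fun i hi => hi
    | cons h _ ih =>
      intro i hi
      obtain ⟨-, j, hj, hj'⟩ := h
      exact ih i (huniq hj hi ▸ hj')
  have hreach2 : ∀ {i : W} (x y : S.verts), (x : V) ∈ φ i → (y : V) ∈ φ i →
      F.Reachable x y := by
    intro i x y hx hy
    have := (hc i).2 ((φ i).filter fun z => ∃ hz : z ∈ S.verts, F.Reachable x ⟨z, hz⟩)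
      (filter_subset _ _) ⟨x, mem_filter.2 ⟨hx, x.2, SimpleGraph.Reachable.refl _⟩⟩
      fun u hu w hw huw => by
        obtain ⟨hui, hu', hr⟩ := mem_filter.1 hu
        refine mem_filter.2 ⟨hw, ⟨i, hw⟩, hr.trans (SimpleGraph.Adj.reachable ?_)⟩
        exact ⟨huw, i, hui, hw⟩
    have hy' := this ▸ hy
    exact (mem_filter.1 hy').2.2
  let r : W → S.verts := fun i => ⟨(hc i).1.choose, i, (hc i).1.choose_spec⟩
  have hr : ∀ i, ((r i : S.verts) : V) ∈ φ i := fun i => (hc i).1.choose_spec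
  let e : W ≃ F.ConnectedComponent :=
      Equiv.ofBijective (fun i => F.connectedComponentMk (r i)) <| by
    constructor
    · intro i j hij
      exact huniq (hreach1 (SimpleGraph.ConnectedComponent.exact hij) i (hr i)) (hr j)
    · intro c
      induction c using SimpleGraph.ConnectedComponent.ind with
      | h v =>
        obtain ⟨i, hi⟩ := v.2
        exact ⟨i, SimpleGraph.ConnectedComponent.sound (hreach2 _ _ (hr i) hi)⟩
  refine ⟨S, F, fun x y ⟨h, i, hx, hy⟩ => ⟨h, i, i, hx, hy, Or.inl rfl⟩, ⟨⟨e, ?_⟩⟩⟩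
  intro i j
  constructor
  · rintro ⟨hne, u, v, hu, hv, huv⟩
    have hui := hreach1 (SimpleGraph.ConnectedComponent.exact hu).symm i (hr i)
    have hvj := hreach1 (SimpleGraph.ConnectedComponent.exact hv).symm j (hr j)
    obtain ⟨-, i', j', hi', hj', hij⟩ := huv
    rw [huniq hui hi', huniq hvj hj']
    rcases hij with rfl | h
    · exact absurd (by rw [huniq hui hi', huniq hvj hj']) hne
    · exact h
  · intro hij
    refine ⟨fun h => hij.ne (e.injective h), ?_⟩
    obtain ⟨x, hx, y, hy, hxy⟩ := hadj i j hij
    exact ⟨⟨x, i, hx⟩, ⟨y, j, hy⟩, SimpleGraph.ConnectedComponent.sound (hreach2 _ _ hx (hr i)),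
      SimpleGraph.ConnectedComponent.sound (hreach2 _ _ hy (hr j)), hxy, i, j, hx, hy, Or.inr hij⟩

theorem Model.of_equiv {W' : Type*} {H : SimpleGraph W} {H' : SimpleGraph W'} (f : W → W')
    (hf : Function.Injective f) (hadj : ∀ i j, H.Adj i j → H'.Adj (f i) (f j))
    (h : Model G H') : Model G H := by
  obtain ⟨φ, h1, h2, h3⟩ := h
  exact ⟨φ ∘ f, fun i => h1 _, fun i j hij => h2 _ _ (hf.ne hij), fun i j h => h3 _ _ (hadj i j h)⟩

/-- Branch sets of a model compose. -/
theorem Model.trans {U : Type*} [DecidableEq V] {G' : SimpleGraph W} {H : SimpleGraph U}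
    (h : Model G' H)
    (β : W → Finset V) (hβ : ∀ t, Conn G (β t)) (hd : ∀ s t, s ≠ t → Disjoint (β s) (β t))
    (hadj : ∀ s t, G'.Adj s t → ∃ x ∈ β s, ∃ y ∈ β t, G.Adj x y) : Model G H := by
  obtain ⟨ψ, h1, h2, h3⟩ := h
  refine ⟨fun i => (ψ i).biUnion β, fun i => ⟨?_, ?_⟩, fun i j hij => ?_, fun i j hij => ?_⟩
  · obtain ⟨t, ht⟩ := (h1 i).1
    obtain ⟨x, hx⟩ := (hβ t).1
    exact ⟨x, mem_biUnion.2 ⟨t, ht, hx⟩⟩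
  · intro P hP hne hcl
    classical
    have hall : ∀ t ∈ ψ i, (∃ x ∈ β t, x ∈ P) → β t ⊆ P := by
      rintro t ht ⟨x, hx, hxP⟩
      have := (hβ t).2 (P ∩ β t) inter_subset_right ⟨x, mem_inter.2 ⟨hxP, hx⟩⟩
        fun u hu w hw huw => mem_inter.2
          ⟨hcl u (mem_inter.1 hu).1 w (mem_biUnion.2 ⟨t, ht, hw⟩) huw, hw⟩
      exact fun y hy => (mem_inter.1 (this ▸ hy)).1
    have := (h1 i).2 ((ψ i).filter fun t => ∃ x ∈ β t, x ∈ P) (filter_subset _ _) ?_ ?_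
    · refine hP.antisymm fun y hy => ?_
      obtain ⟨t, ht, hyt⟩ := mem_biUnion.1 hy
      have ht' := this ▸ ht
      exact hall t ht (mem_filter.1 ht').2 hyt
    · obtain ⟨p, hp⟩ := hne
      obtain ⟨t, ht, hpt⟩ := mem_biUnion.1 (hP hp)
      exact ⟨t, mem_filter.2 ⟨ht, p, hpt, hp⟩⟩
    · intro s hs t ht hst
      obtain ⟨hs1, hs2⟩ := mem_filter.1 hs
      obtain ⟨x, hx, y, hy, hxy⟩ := hadj s t hst
      exact mem_filter.2 ⟨ht, y, hy, hcl x (hall s hs1 hs2 hx) y (mem_biUnion.2 ⟨t, ht, hy⟩) hxy⟩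
  · rw [disjoint_left]
    intro x hx hx'
    obtain ⟨s, hs, hxs⟩ := mem_biUnion.1 hx
    obtain ⟨t, ht, hxt⟩ := mem_biUnion.1 hx'
    have hst : s ≠ t := fun h => disjoint_left.1 (h2 i j hij) hs (h ▸ ht)
    exact disjoint_left.1 (hd s t hst) hxs hxt
  · obtain ⟨s, hs, t, ht, hst⟩ := h3 i j hij
    obtain ⟨x, hx, y, hy, hxy⟩ := hadj s t hst
    exact ⟨x, mem_biUnion.2 ⟨s, hs, hx⟩, y, mem_biUnion.2 ⟨t, ht, hy⟩, hxy⟩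

/-- A `K₄,₄⁻` model from rows and columns. -/
theorem model_K44Minus (r k : Fin 4 → Finset V) (hr : ∀ i, Conn G (r i)) (hk : ∀ j, Conn G (k j))
    (hrr : ∀ i j, i ≠ j → Disjoint (r i) (r j)) (hkk : ∀ i j, i ≠ j → Disjoint (k i) (k j))
    (hrk : ∀ i j, Disjoint (r i) (k j))
    (hadj : ∀ i j, (i, j) ≠ (0, 0) → ∃ x ∈ r i, ∃ y ∈ k j, G.Adj x y) : Model G K44Minus := by
  refine ⟨Sum.elim r k, ?_, ?_, ?_⟩
  · rintro (i | i)
    exacts [hr i, hk i]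
  · rintro (i | i) (j | j) hij
    · exact hrr i j (by simpa using hij)
    · exact hrk i j
    · exact (hrk j i).symm
    · exact hkk i j (by simpa using hij)
  · rintro (i | i) (j | j) hij
    · simp [K44Minus] at hij
    · refine hadj i j fun h => ?_
      simp only [Prod.mk.injEq] at h
      obtain ⟨rfl, rfl⟩ := h
      simp [K44Minus] at hij
    · obtain ⟨x, hx, y, hy, hxy⟩ := hadj j i fun h => by
        simp only [Prod.mk.injEq] at h
        obtain ⟨rfl, rfl⟩ := h
        simp [K44Minus] at hij
      exact ⟨y, hy, x, hx, hxy.symm⟩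
    · simp [K44Minus] at hij

/-- A `K₆` model indexed by any type with six elements. -/
theorem model_K6 [Fintype W] (hW : Fintype.card W = 6) (φ : W → Finset V)
    (h1 : ∀ i, Conn G (φ i)) (h2 : ∀ i j, i ≠ j → Disjoint (φ i) (φ j))
    (h3 : ∀ i j, i ≠ j → ∃ x ∈ φ i, ∃ y ∈ φ j, G.Adj x y) : Model G K6 := by
  have e : Fin 6 ≃ W := (Fintype.equivFinOfCardEq hW).symm
  exact Model.of_equiv (H' := (⊤ : SimpleGraph W)) e e.injective
    (fun i j h => by simpa using h.ne) ⟨φ, h1, h2, fun i j h => h3 i j (by simpa using h)⟩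

end Models

end BipartiteMinors

namespace BipartiteMinors

open Finset
open scoped Classical

/-! ### Minimal counterexamples and their reductions -/

section MinimalCounterexample

variable {V : Type*}

/-- The edges inside `T`, oriented from the colour `σ`. -/
noncomputable def edgesIn (G : SimpleGraph V) (c : V → Bool) (σ : Bool) (T : Finset V) :
    Finset (V × V) :=
  (T ×ˢ T).filter fun p => c p.1 = σ ∧ G.Adj p.1 p.2

@[simp] theorem mem_edgesIn {G : SimpleGraph V} {c : V → Bool} {σ : Bool} {T : Finset V}
    {p : V × V} :
    p ∈ edgesIn G c σ T ↔ p.1 ∈ T ∧ p.2 ∈ T ∧ c p.1 = σ ∧ G.Adj p.1 p.2 := by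
  simp [edgesIn, and_assoc]

variable [Fintype V]

/-- The neighbours of a vertex. -/
noncomputable def nb (G : SimpleGraph V) (v : V) : Finset V := univ.filter fun y => G.Adj v y

@[simp] theorem mem_nb {G : SimpleGraph V} {v y : V} : y ∈ nb G v ↔ G.Adj v y := by simp [nb]

/-- A smallest two-coloured graph with both colour classes large, without the two minors, having
exactly `3n - 9` edges. The field `reduce` is the induction hypothesis, for minors whose vertices
are represented by the set `T`. -/
structure MinimalCounterexample (G : SimpleGraph V) (c : V → Bool) : Prop where
  proper : ∀ x y, G.Adj x y → c x ≠ c y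
  no_K44Minus : ¬ Model G K44Minus
  no_K6 : ¬ Model G K6
  parts : ∀ σ, 5 ≤ (univ.filter fun x => c x = σ).card
  four_le_degree : ∀ v, 4 ≤ (nb G v).card
  edges : ∀ σ, (edgesIn G c σ univ).card + 9 = 3 * Fintype.card V
  reduce : ∀ (σ : Bool) (T : Finset V) (E : Finset (V × V)) (β : V → Finset V),
    T.card < Fintype.card V → (∀ τ, 4 ≤ (T.filter fun x => c x = τ).card) →
    (∀ p ∈ E, p.1 ∈ T ∧ p.2 ∈ T ∧ c p.1 = σ ∧ c p.2 = !σ ∧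
      ∃ x ∈ β p.1, ∃ y ∈ β p.2, G.Adj x y) →
    (∀ t ∈ T, Conn G (β t)) → (∀ s ∈ T, ∀ t ∈ T, s ≠ t → Disjoint (β s) (β t)) →
    E.card + 10 ≤ 3 * T.card

namespace MinimalCounterexample

variable {G : SimpleGraph V} {c : V → Bool}

theorem color_eq_not (h : MinimalCounterexample G c) {x y : V} (hxy : G.Adj x y) :
    c y = !(c x) := by
  have := h.proper x y hxy
  revert this
  cases c x <;> cases c y <;> simp

/-- The induction hypothesis for the contraction of `K` onto its vertex `q`. -/
theorem reduce_contract (h : MinimalCounterexample G c) (σ : Bool) {T K M : Finset V} {q : V}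
    (hT : T.card < Fintype.card V) (hparts : ∀ τ, 4 ≤ (T.filter fun x => c x = τ).card)
    (hqT : q ∈ T) (hK : Conn G K) (hqK : q ∈ K) (hKT : ∀ x ∈ K, x ∈ T → x = q)
    (hq : c q = !σ) (hMT : M ⊆ T) (hMσ : ∀ m ∈ M, c m = σ) (hM : ∀ m ∈ M, Touches G K m) :
    (edgesIn G c σ T ∪ M ×ˢ {q}).card + 10 ≤ 3 * T.card := by
  have hqσ : ∀ m, c m = σ → m ≠ q := by
    rintro m hm rfl
    rw [hm] at hq
    cases σ <;> simp at hq
  refine h.reduce σ T _ (fun t => if t = q then K else {t}) hT hparts ?_ ?_ ?_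
  · intro p hp
    rcases mem_union.1 hp with hp | hp
    · obtain ⟨h1, h2, h3, h4⟩ := mem_edgesIn.1 hp
      refine ⟨h1, h2, h3, h3 ▸ h.color_eq_not h4, p.1, by simp [hqσ _ h3], p.2, ?_, h4⟩
      by_cases hpq : p.2 = q
      · simp [hpq, hqK]
      · simp [hpq]
    · simp only [mem_product, mem_singleton] at hp
      obtain ⟨x, hx, hxm⟩ := hM _ hp.1
      refine ⟨hMT hp.1, hp.2 ▸ hqT, hMσ _ hp.1, hp.2 ▸ hq, p.1, by simp [hqσ _ (hMσ _ hp.1)],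
        x, by simp [hp.2, hx], hxm.symm⟩
  · intro t _
    by_cases htq : t = q
    · simpa [htq] using hK
    · simpa [htq] using conn_singleton t
  · intro s hs t ht hst
    by_cases hsq : s = q
    · have htq : t ≠ q := fun h => hst (hsq.trans h.symm)
      simp only [hsq, if_true, htq, if_false, disjoint_singleton_right]
      exact fun htK => htq (hKT t htK ht)
    · by_cases htq : t = q
      · simp only [hsq, if_false, htq, if_true, disjoint_singleton_left]
        exact fun hsK => hsq (hKT s hsK hs)
      · simpa [hsq, htq] using hst

theorem reduce_induce (h : MinimalCounterexample G c) (σ : Bool) {T : Finset V}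
    (hT : T.card < Fintype.card V) (hparts : ∀ τ, 4 ≤ (T.filter fun x => c x = τ).card) :
    (edgesIn G c σ T).card + 10 ≤ 3 * T.card := by
  refine h.reduce σ T _ (fun t => {t}) hT hparts ?_ (fun t _ => conn_singleton t)
    (fun s _ t _ hst => by simpa using hst)
  intro p hp
  obtain ⟨h1, h2, h3, h4⟩ := mem_edgesIn.1 hp
  exact ⟨h1, h2, h3, h3 ▸ h.color_eq_not h4, p.1, by simp, p.2, by simp, h4⟩

/-- Merging a connected set outside `T` into a vertex `b` of `T`. -/
theorem reduce_merge (h : MinimalCounterexample G c) (σ : Bool) {T K M : Finset V} {b : V}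
    (hparts : ∀ τ, 4 ≤ (T.filter fun x => c x = τ).card)
    (hbT : b ∈ T) (hK : Conn G K) (hKT : Disjoint K T) (hbK : Touches G K b)
    (hb : c b = !σ) (hMT : M ⊆ T) (hMσ : ∀ m ∈ M, c m = σ) (hM : ∀ m ∈ M, Touches G K m) :
    (edgesIn G c σ T).card + M.card + 10 ≤ 3 * T.card + (M.filter fun m => G.Adj b m).card := by
  have hT : T.card < Fintype.card V := by
    obtain ⟨x, hx⟩ := hK.1
    rw [← card_univ]
    exact card_lt_card (ssubset_univ_iff.2 fun hu => disjoint_left.1 hKT hx (hu ▸ mem_univ x))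
  have key := h.reduce_contract (M := M) σ hT hparts hbT (Conn.insert hK hbK) (mem_insert_self _ _)
    (fun x hx hxT => (mem_insert.1 hx).resolve_right fun hxK => disjoint_left.1 hKT hxK hxT)
    hb hMT hMσ (fun m hm => (hM m hm).mono (subset_insert _ _))
  -- Only members of `M` not already adjacent to `b` yield new edges; this is the correction term on
  -- the right of the bound.
  have hcard : (edgesIn G c σ T).card + (M.filter fun m => ¬ G.Adj b m).card ≤
      (edgesIn G c σ T ∪ M ×ˢ {b}).card := by
    have : (M.filter fun m => ¬ G.Adj b m).card =
        ((M.filter fun m => ¬ G.Adj b m) ×ˢ ({b} : Finset V)).card := by simp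
    rw [this, ← card_union_of_disjoint]
    · exact card_le_card (union_subset_union_right
        (product_subset_product_left (filter_subset _ _)))
    · rw [disjoint_left]
      intro p hp hp'
      simp only [mem_product, mem_filter, mem_singleton] at hp'
      have := (mem_edgesIn.1 hp).2.2.2
      rw [hp'.2] at this
      exact hp'.1.2 this.symm
  have := card_filter_add_card_filter_not (s := M) (fun m => G.Adj b m)
  omega

/-- Contracting a connected set outside `T` to a new vertex. -/
theorem reduce_new (h : MinimalCounterexample G c) (σ : Bool) {T K M : Finset V} {q : V}
    (hT : T.card + 1 < Fintype.card V)
    (hparts : ∀ τ, 4 ≤ (T.filter fun x => c x = τ).card)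
    (hK : Conn G K) (hKT : Disjoint K T) (hqK : q ∈ K)
    (hq : c q = !σ) (hMT : M ⊆ T) (hMσ : ∀ m ∈ M, c m = σ) (hM : ∀ m ∈ M, Touches G K m) :
    (edgesIn G c σ T).card + M.card + 10 ≤ 3 * T.card + 3 := by
  have hqT : q ∉ T := fun hqT => disjoint_left.1 hKT hqK hqT
  have key := h.reduce_contract (T := insert q T) (M := M) σ (by rwa [card_insert_of_notMem hqT])
    (fun τ => (hparts τ).trans (card_le_card (filter_subset_filter _ (subset_insert _ _))))
    (mem_insert_self _ _) hK hqK
    (fun x hx hxT => (mem_insert.1 hxT).resolve_right fun hxT => disjoint_left.1 hKT hx hxT)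
    hq (hMT.trans (subset_insert _ _)) hMσ hM
  rw [card_insert_of_notMem hqT] at key
  have hcard : (edgesIn G c σ T).card + M.card ≤
      (edgesIn G c σ (insert q T) ∪ M ×ˢ {q}).card := by
    have : M.card = (M ×ˢ ({q} : Finset V)).card := by simp
    rw [this, ← card_union_of_disjoint]
    · refine card_le_card (union_subset_union_left fun p hp => ?_)
      rw [mem_edgesIn] at hp ⊢
      exact ⟨mem_insert_of_mem hp.1, mem_insert_of_mem hp.2.1, hp.2.2⟩
    · rw [disjoint_left]
      intro p hp hp'
      simp only [mem_product, mem_singleton] at hp'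
      have := (mem_edgesIn.1 hp).2.1
      rw [hp'.2] at this
      exact hqT this
  omega

/-- Two neighbours of a vertex of small degree have many common neighbours. -/
theorem eight_le (h : MinimalCounterexample G c) {v a b : V} (hab : a ≠ b) (ha : G.Adj v a)
    (hb : G.Adj v b) : 8 ≤ (nb G v).card + (nb G a ∩ nb G b).card := by
  have hca : c a = !(c v) := h.color_eq_not ha
  have hcb : c b = !(c v) := h.color_eq_not hb
  have hav : v ≠ a := ha.ne
  have hbv : v ≠ b := hb.ne
  -- The path a v b is contracted onto `a`. Two vertices disappear and deg v + |N(a) ∩ N(b)| - 1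
  -- edges are lost, `v` being itself a common neighbour. Passing from 3n-9 edges to at most
  -- 3(n-2)-10 requires losing at least seven.
  set T : Finset V := univ \ {v, b} with hT
  set E₁ := edgesIn G c (c a) T with hE₁
  have hTc : T.card + 2 = Fintype.card V := by
    have : ({v, b} : Finset V).card = 2 := card_pair hbv
    rw [hT, card_sdiff_of_subset (subset_univ _), this, card_univ]
    have := card_le_univ ({v, b} : Finset V)
    omega
  have haT : a ∈ T := by simp [hT, hav.symm, hab]
  -- `v` and `b` have different colours, so each class loses just one of its at least five vertices.
  have hparts : ∀ τ, 4 ≤ (T.filter fun x => c x = τ).card := by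
    intro τ
    have h5 := h.parts τ
    have : (univ.filter fun x => c x = τ) ⊆
        (T.filter fun x => c x = τ) ∪ {if c v = τ then v else b} := by
      intro x hx
      simp only [mem_filter, mem_univ, true_and] at hx
      simp only [mem_union, mem_filter, hT, mem_sdiff, mem_univ, true_and, mem_insert,
        mem_singleton, not_or]
      by_cases hxv : x = v
      · right; rw [if_pos (hxv ▸ hx), hxv]
      · by_cases hxb : x = b
        · right
          rw [if_neg, hxb]
          intro hcv
          rw [hxb, hcb, hcv] at hx
          cases τ <;> simp at hx
        · exact Or.inl ⟨⟨hxv, hxb⟩, hx⟩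
    have := (card_le_card this).trans (card_union_le _ _)
    rw [card_singleton] at this
    omega
  set E₂ : Finset (V × V) := ({a} : Finset V) ×ˢ (nb G b \ nb G a) with hE₂
  have hvE₂ : ∀ p ∈ E₂, p.2 ≠ v := by
    rintro p hp rfl
    simp only [hE₂, mem_product, mem_sdiff, mem_nb] at hp
    exact hp.2.2 ha.symm
  have hcard : (E₁ ∪ E₂).card + 10 ≤ 3 * T.card := by
    refine h.reduce (c a) T _ (fun t => if t = a then {v, a, b} else {t}) (by omega) hparts
      ?_ ?_ ?_
    · intro p hp
      rcases mem_union.1 hp with hp | hp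
      · obtain ⟨h1, h2, h3, h4⟩ := mem_edgesIn.1 hp
        have hpa : p.2 ≠ a := fun h => by
          have := hca ▸ h3
          have := h.symm ▸ h4
          exact (‹MinimalCounterexample G c›.proper _ _ this) h3
        refine ⟨h1, h2, h3, h3 ▸ h.color_eq_not h4, p.1, ?_, p.2, by simp [hpa], h4⟩
        by_cases hpa : p.1 = a <;> simp [hpa]
      · have hpv := hvE₂ p hp
        simp only [hE₂, mem_product, mem_singleton, mem_sdiff, mem_nb] at hp
        have hpb : p.2 ≠ b := hp.2.1.ne'
        have hpa : p.2 ≠ a := fun h' => by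
          have := h.proper _ _ (h' ▸ hp.2.1)
          exact this (hcb.trans hca.symm)
        refine ⟨hp.1 ▸ haT, by simp [hT, hpv, hpb], by rw [hp.1], ?_, b, by simp [hp.1], p.2,
          by simp [hpa], hp.2.1⟩
        rw [h.color_eq_not hp.2.1, hcb, hca]
    · intro t _
      by_cases hta : t = a
      · simp only [hta, if_true]
        exact conn_insert_star (by simp [ha, hb])
      · simpa [hta] using conn_singleton t
    · intro s hs t ht hst
      simp only [hT, mem_sdiff, mem_univ, true_and, mem_insert, mem_singleton, not_or] at hs ht
      by_cases hsa : s = a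
      · have hta : t ≠ a := fun h => hst (hsa.trans h.symm)
        simp [hsa, hta, ht.1, ht.2]
      · by_cases hta : t = a
        · simp [hsa, hta, hs.1, hs.2]
        · simpa [hsa, hta] using hst
  have hdisj : Disjoint E₁ E₂ := by
    rw [disjoint_left]
    intro p hp hp'
    simp only [hE₂, mem_product, mem_singleton, mem_sdiff, mem_nb] at hp'
    have := (mem_edgesIn.1 hp).2.2.2
    exact hp'.2.2 (hp'.1 ▸ this)
  rw [card_union_of_disjoint hdisj] at hcard
  have hE₂c : E₂.card + (nb G a ∩ nb G b).card = (nb G b).card := by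
    rw [hE₂, card_product, card_singleton, one_mul, inter_comm]
    exact card_sdiff_add_card_inter _ _
  have hall : edgesIn G c (c a) univ ⊆
      E₁ ∪ (nb G v) ×ˢ {v} ∪ ({b} : Finset V) ×ˢ ((nb G b).erase v) := by
    intro p hp
    obtain ⟨-, -, h3, h4⟩ := mem_edgesIn.1 hp
    simp only [mem_union, hE₁, mem_edgesIn, hT, mem_sdiff, mem_univ, true_and, mem_insert,
      mem_singleton, not_or, mem_product, mem_nb, mem_erase]
    have hp1 : p.1 ≠ v := fun h' => by
      rw [h', hca] at h3
      cases hcv : c v <;> simp [hcv] at h3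
    have hp2 : p.2 ≠ b := fun h' => by
      have := h.proper _ _ h4
      rw [h', h3, hca, hcb] at this
      exact this rfl
    by_cases h5 : p.2 = v
    · exact Or.inl (Or.inr ⟨h5 ▸ h4.symm, h5⟩)
    · by_cases h6 : p.1 = b
      · exact Or.inr ⟨h6, h5, h6 ▸ h4⟩
      · exact Or.inl (Or.inl ⟨⟨hp1, h6⟩, ⟨h5, hp2⟩, h3, h4⟩)
  have h1 := (card_le_card hall).trans ((card_union_le _ _).trans
    (Nat.add_le_add_right (card_union_le _ _) _))
  simp only [card_product, card_singleton, mul_one, one_mul] at h1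
  rw [card_erase_of_mem (mem_nb.2 hb.symm)] at h1
  have h2 := h.edges (c a)
  have h3 : 0 < (nb G b).card := card_pos.2 ⟨v, mem_nb.2 hb.symm⟩
  omega

end MinimalCounterexample

end MinimalCounterexample

end BipartiteMinors

namespace BipartiteMinors

open Finset
open scoped Classical

/-! ### Small separations -/

section Cuts

variable {V : Type*} [Fintype V]

namespace MinimalCounterexample

variable {G : SimpleGraph V} {c : V → Bool}

/-- The neighbourhoods of the two ends of an edge lie in opposite classes, and each has at least
four vertices. -/
theorem four_le_part (h : MinimalCounterexample G c) {T : Finset V} {x y : V} (hxy : G.Adj x y)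
    (hx : nb G x ⊆ T) (hy : nb G y ⊆ T) (τ : Bool) : 4 ≤ (T.filter fun z => c z = τ).card := by
  have key : ∀ u, nb G u ⊆ T → c u = !τ → 4 ≤ (T.filter fun z => c z = τ).card := by
    intro u hu hcu
    refine (h.four_le_degree u).trans (card_le_card fun z hz => mem_filter.2 ⟨hu hz, ?_⟩)
    rw [h.color_eq_not (mem_nb.1 hz), hcu, Bool.not_not]
  by_cases hcx : c x = τ
  · exact key y hy (by rw [h.color_eq_not hxy, hcx])
  · exact key x hx (by revert hcx; cases c x <;> cases τ <;> simp)

/-- At most four vertices of one colour and two of the other do not separate two edges. -/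
theorem no_edge_cut (h : MinimalCounterexample G c) (σ : Bool) {K A B : Finset V} (hK : Conn G K)
    (hcl : ∀ x ∈ K, ∀ y, G.Adj x y → y ∈ K ∨ y ∈ A ∨ y ∈ B)
    (hA : A.card ≤ 4) (hB : B.card ≤ 2) (hAσ : ∀ a ∈ A, c a = σ) (hBσ : ∀ b ∈ B, c b = !σ)
    (hK2 : 2 ≤ K.card) {p q : V} (hpq : G.Adj p q) (hpK : p ∉ K) (hpA : p ∉ A) (hpB : p ∉ B)
    (hqK : q ∉ K) (hqA : q ∉ A) (hqB : q ∉ B) : False := by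
  -- `S` is the true neighbourhood of `K`, `Q` the component of `p` beyond it, and `S₂ ⊆ S` the
  -- neighbourhood of `Q`. Every vertex of `S₂` touches both `K` and `Q`. So `Q` can be contracted
  -- within the side `L`, and `K` within the side `R`, to add edges at the cut.
  set S : Finset V := univ.filter fun y => y ∉ K ∧ Touches G K y with hS
  have hSAB : S ⊆ A ∪ B := by
    intro y hy
    obtain ⟨-, hyK, x, hx, hxy⟩ := mem_filter.1 hy
    exact mem_union.2 ((hcl x hx y hxy).resolve_left hyK)
  have hpS : p ∉ S := fun hp => by
    rcases mem_union.1 (hSAB hp) with hp | hp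
    exacts [hpA hp, hpB hp]
  have hqS : q ∉ S := fun hq => by
    rcases mem_union.1 (hSAB hq) with hq | hq
    exacts [hqA hq, hqB hq]
  obtain ⟨Q, hQs, hpQ, hQ, hQcl⟩ := exists_component (G := G) (univ \ (K ∪ S)) (x₀ := p)
    (by simp [hpK, hpS])
  have hqQ : q ∈ Q := hQcl p hpQ q (by simp [hqK, hqS]) hpq
  have hKQ : Disjoint K Q := disjoint_left.2 fun x hx hxQ => by
    have := hQs hxQ
    simp [hx] at this
  set S₂ : Finset V := univ.filter fun y => y ∉ Q ∧ Touches G Q y with hS₂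
  have hS₂S : S₂ ⊆ S := by
    intro y hy
    obtain ⟨-, hyQ, x, hx, hxy⟩ := mem_filter.1 hy
    by_contra hyS
    by_cases hyK : y ∈ K
    · have hxs := hQs hx
      simp only [mem_sdiff, mem_univ, true_and, mem_union, not_or] at hxs
      exact hxs.2 (mem_filter.2 ⟨mem_univ _, hxs.1, y, hyK, hxy.symm⟩)
    · exact hyQ (hQcl x hx y (by simp [hyK, hyS]) hxy)
  have hS₂K : ∀ y ∈ S₂, Touches G K y := fun y hy => (mem_filter.1 (hS₂S hy)).2.2
  have hS₂Q : ∀ y ∈ S₂, Touches G Q y := fun y hy => (mem_filter.1 hy).2.2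
  have hS₂nQ : Disjoint S₂ Q := disjoint_left.2 fun y hy => (mem_filter.1 hy).2.1
  have hS₂nK : Disjoint S₂ K := disjoint_left.2 fun y hy => (mem_filter.1 (hS₂S hy)).2.1
  set L : Finset V := univ \ Q with hL
  set R : Finset V := Q ∪ S₂ with hR
  have hLR : L ∩ R = S₂ := by
    ext y
    simp only [hL, hR, mem_inter, mem_sdiff, mem_univ, true_and, mem_union]
    constructor
    · tauto
    · exact fun hy => ⟨fun hyQ => disjoint_left.1 hS₂nQ hy hyQ, Or.inr hy⟩
  have hLRu : L ∪ R = univ := by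
    ext y
    simp only [hL, hR, mem_sdiff, mem_univ, true_and, mem_union, iff_true]
    tauto
  have hcardV : L.card + R.card = Fintype.card V + S₂.card := by
    rw [← card_union_add_card_inter, hLR, hLRu, card_univ]
  have hE : (edgesIn G c σ L).card + (edgesIn G c σ R).card =
      (edgesIn G c σ univ).card + (edgesIn G c σ S₂).card := by
    rw [← card_union_add_card_inter]
    congr 2
    · ext ⟨x, y⟩
      simp only [mem_union, mem_edgesIn, mem_univ, true_and]
      constructor
      · tauto
      · rintro ⟨h1, h2⟩
        have hQR : ∀ u w, u ∈ Q → G.Adj u w → w ∈ R := fun u w hu huw => by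
          by_cases hw : w ∈ Q
          · exact mem_union_left _ hw
          · exact mem_union_right _ (mem_filter.2 ⟨mem_univ _, hw, u, hu, huw⟩)
        by_cases hx : x ∈ Q
        · exact Or.inr ⟨mem_union_left _ hx, hQR x y hx h2, h1, h2⟩
        · by_cases hy : y ∈ Q
          · exact Or.inr ⟨hQR y x hy h2.symm, mem_union_left _ hy, h1, h2⟩
          · exact Or.inl ⟨by simp [hL, hx], by simp [hL, hy], h1, h2⟩
    · rw [← hLR]
      ext ⟨x, y⟩
      simp only [mem_inter, mem_edgesIn]
      tauto
  have hKL : Disjoint K R := by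
    rw [hR, disjoint_union_right]
    exact ⟨hKQ, hS₂nK.symm⟩
  have hQL : Disjoint Q L := disjoint_sdiff
  obtain ⟨k₀, hk₀, k₁, hk₁, hk⟩ : ∃ x ∈ K, ∃ y ∈ K, G.Adj x y := by
    obtain ⟨x, hx⟩ := hK.1
    by_contra hno
    push Not at hno
    have := hK.2 {x} (singleton_subset_iff.2 hx) (singleton_nonempty x) fun u hu w hw huw =>
      absurd huw (hno u (mem_singleton.1 hu ▸ hx) w hw)
    rw [← this, card_singleton] at hK2
    omega
  have hRn : ∀ u ∈ Q, nb G u ⊆ R := fun u hu w hw => by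
    by_cases hwQ : w ∈ Q
    · exact mem_union_left _ hwQ
    · exact mem_union_right _ (mem_filter.2 ⟨mem_univ _, hwQ, u, hu, mem_nb.1 hw⟩)
  have hLn : ∀ u ∈ K, nb G u ⊆ L := fun u hu w hw => by
    refine mem_sdiff.2 ⟨mem_univ _, fun hwQ => ?_⟩
    have hu' := hRn w hwQ (mem_nb.2 (mem_nb.1 hw).symm)
    exact disjoint_left.1 hKL hu hu'
  have hLp : ∀ τ, 4 ≤ (L.filter fun z => c z = τ).card :=
    h.four_le_part hk (hLn _ hk₀) (hLn _ hk₁)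
  have hRp : ∀ τ, 4 ≤ (R.filter fun z => c z = τ).card :=
    h.four_le_part hpq (hRn _ hpQ) (hRn _ hqQ)
  have hQ2 : 2 ≤ Q.card := by
    rw [← card_pair hpq.ne]
    exact card_le_card (by simp [insert_subset_iff, hpQ, hqQ])
  have hLc : L.card + Q.card = Fintype.card V := by
    rw [hL, card_sdiff_of_subset (subset_univ _), card_univ]
    exact Nat.sub_add_cancel (card_le_univ _)
  have hRc : R.card + K.card ≤ Fintype.card V := by
    rw [← card_union_of_disjoint hKL.symm]
    exact card_le_univ _
  -- the two colours of the cut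
  set A₂ := S₂.filter fun x => c x = σ with hA₂
  set B₂ := S₂.filter fun x => ¬ c x = σ with hB₂
  have hS₂c : A₂.card + B₂.card = S₂.card := card_filter_add_card_filter_not _
  have hσ : ∀ x, c x = σ ↔ ¬ c x = !σ := fun x => by cases c x <;> cases σ <;> simp
  have hA₂A : A₂ ⊆ A := fun x hx => by
    obtain ⟨hx, hcx⟩ := mem_filter.1 hx
    exact (mem_union.1 (hSAB (hS₂S hx))).resolve_right fun hxB => (hσ x).1 hcx (hBσ x hxB)
  have hB₂B : B₂ ⊆ B := fun x hx => by
    obtain ⟨hx, hcx⟩ := mem_filter.1 hx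
    exact (mem_union.1 (hSAB (hS₂S hx))).resolve_left fun hxA => hcx (hAσ x hxA)
  have hα : A₂.card ≤ 4 := (card_le_card hA₂A).trans hA
  have hβ : B₂.card ≤ 2 := (card_le_card hB₂B).trans hB
  have hA₂σ : ∀ m ∈ A₂, c m = σ := fun m hm => (mem_filter.1 hm).2
  have hA₂S : A₂ ⊆ S₂ := filter_subset _ _
  have hS₂L : S₂ ⊆ L := hLR ▸ inter_subset_left
  have hS₂R : S₂ ⊆ R := hLR ▸ inter_subset_right
  have hmerge : ∀ b ∈ B₂, (edgesIn G c σ L).card + A₂.card + 10 ≤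
      3 * L.card + (A₂.filter fun m => G.Adj b m).card ∧
      (edgesIn G c σ R).card + A₂.card + 10 ≤
      3 * R.card + (A₂.filter fun m => G.Adj b m).card := by
    intro b hb
    have hbS : b ∈ S₂ := (mem_filter.1 hb).1
    exact ⟨h.reduce_merge σ hLp (hS₂L hbS) hQ hQL (hS₂Q b hbS) (hBσ b (hB₂B hb))
      (hA₂S.trans hS₂L) hA₂σ (fun m hm => hS₂Q m (hA₂S hm)),
      h.reduce_merge σ hRp (hS₂R hbS) hK hKL (hS₂K b hbS) (hBσ b (hB₂B hb))
      (hA₂S.trans hS₂R) hA₂σ (fun m hm => hS₂K m (hA₂S hm))⟩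
  have hnew : (edgesIn G c σ L).card + A₂.card + 10 ≤ 3 * L.card + 3 ∧
      (edgesIn G c σ R).card + A₂.card + 10 ≤ 3 * R.card + 3 := by
    have hpick : ∀ u w, G.Adj u w → ∃ z, (z = u ∨ z = w) ∧ c z = !σ := fun u w huw => by
      by_cases hu : c u = σ
      · exact ⟨w, Or.inr rfl, by rw [h.color_eq_not huw, hu]⟩
      · exact ⟨u, Or.inl rfl, by revert hu; cases c u <;> cases σ <;> simp⟩
    obtain ⟨z, hz, hcz⟩ := hpick p q hpq
    obtain ⟨y, hy, hcy⟩ := hpick k₀ k₁ hk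
    exact ⟨h.reduce_new σ (by omega) hLp hQ hQL (by rcases hz with rfl | rfl <;> assumption) hcz
      (hA₂S.trans hS₂L) hA₂σ (fun m hm => hS₂Q m (hA₂S hm)),
      h.reduce_new σ (by omega) hRp hK hKL (by rcases hy with rfl | rfl <;> assumption) hcy
      (hA₂S.trans hS₂R) hA₂σ (fun m hm => hS₂K m (hA₂S hm))⟩
  have hplain : (edgesIn G c σ L).card + 10 ≤ 3 * L.card ∧
      (edgesIn G c σ R).card + 10 ≤ 3 * R.card :=
    ⟨h.reduce_induce σ (by omega) hLp, h.reduce_induce σ (by omega) hRp⟩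
  have hedges := h.edges σ
  have hsb : ∀ b ∈ B₂, (A₂.filter fun m => G.Adj b m) ×ˢ ({b} : Finset V) ⊆
      edgesIn G c σ S₂ := by
    intro b hb x hx
    simp only [mem_product, mem_filter, mem_singleton] at hx
    rw [mem_edgesIn, hx.2]
    exact ⟨hA₂S hx.1.1, (mem_filter.1 hb).1, hA₂σ _ hx.1.1, hx.1.2.symm⟩
  have hsc : ∀ b, ((A₂.filter fun m => G.Adj b m) ×ˢ ({b} : Finset V)).card =
      (A₂.filter fun m => G.Adj b m).card := fun b => by simp
  have hsA : ∀ b, (A₂.filter fun m => G.Adj b m).card ≤ A₂.card := fun b =>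
    card_le_card (filter_subset _ _)
  -- Let α = |A₂|, let e be the number of edges inside S₂, and let s(b) count the neighbours of b in
  -- A₂. The two sides have 3n-9+e edges and n+|S₂| vertices in total. If B₂ is empty, adding the
  -- bounds `hnew` gives 5+e ≤ α. If B₂ = {b}, merging gives 8+e ≤ α+2s(b) with s(b) ≤ e, so α =
  -- s(b) = 4, and then `hnew` fails. If B₂ has two vertices, merging into each gives 5+e ≤ α+2s(b);
  -- the sum of both with s(b₁)+s(b₂) ≤ e yields 5 ≤ α. All contradict α ≤ 4.
  have hcases : B₂.card = 0 ∨ B₂.card = 1 ∨ B₂.card = 2 := by omega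
  rcases hcases with h0 | h1 | h2
  · omega
  · obtain ⟨b, hb⟩ := card_eq_one.1 h1
    have hbB : b ∈ B₂ := hb ▸ mem_singleton_self b
    have h3 := hmerge b hbB
    have h4 := card_le_card (hsb b hbB)
    rw [hsc] at h4
    have h5 := hsA b
    omega
  · obtain ⟨b₁, b₂, hne, hb⟩ := card_eq_two.1 h2
    have hb₁ : b₁ ∈ B₂ := by simp [hb]
    have hb₂ : b₂ ∈ B₂ := by simp [hb]
    have h3 := hmerge b₁ hb₁
    have h4 := hmerge b₂ hb₂
    have h5 := card_le_card (union_subset (hsb b₁ hb₁) (hsb b₂ hb₂))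
    rw [card_union_of_disjoint, hsc, hsc] at h5
    · omega
    · rw [disjoint_left]
      intro x hx hx'
      simp only [mem_product, mem_singleton] at hx hx'
      exact hne (hx.2.symm.trans hx'.2)

/-- At most three vertices of one colour and two of the other do not separate the graph. -/
theorem no_cut (h : MinimalCounterexample G c) (σ : Bool) {K A B : Finset V} (hK : Conn G K)
    (hcl : ∀ x ∈ K, ∀ y, G.Adj x y → y ∈ K ∨ y ∈ A ∨ y ∈ B)
    (hA : A.card ≤ 3) (hB : B.card ≤ 2) (hAσ : ∀ a ∈ A, c a = σ) (hBσ : ∀ b ∈ B, c b = !σ)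
    {p : V} (hpK : p ∉ K) (hpA : p ∉ A) (hpB : p ∉ B) : False := by
  -- The neighbours of a vertex have one colour and number at least four, so neither `A` nor `B` can
  -- contain them all. Hence there is an edge on each side of the cut.
  have key : ∀ x, ∃ y, G.Adj x y ∧ y ∉ A ∧ y ∉ B := by
    intro x
    by_contra hno
    push Not at hno
    have h4 := h.four_le_degree x
    by_cases hcx : c x = σ
    · have : nb G x ⊆ B := fun y hy => hno y (mem_nb.1 hy) fun hyA =>
        h.proper x y (mem_nb.1 hy) (hcx.trans (hAσ y hyA).symm)
      have := card_le_card this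
      omega
    · have : nb G x ⊆ A := fun y hy => by
        by_contra hyA
        have hyB := hno y (mem_nb.1 hy) hyA
        refine h.proper x y (mem_nb.1 hy) ?_
        rw [hBσ y hyB]
        revert hcx; cases c x <;> cases σ <;> simp
      have := card_le_card this
      omega
  obtain ⟨q, hpq, hqA, hqB⟩ := key p
  obtain ⟨x, hx⟩ := hK.1
  obtain ⟨y, hxy, hyA, hyB⟩ := key x
  have hyK : y ∈ K := ((hcl x hx y hxy).resolve_right fun h => h.elim hyA hyB)
  have hqK : q ∉ K := fun hq =>
    ((hcl q hq p hpq.symm).elim hpK fun h => h.elim hpA hpB)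
  refine h.no_edge_cut σ hK hcl (by omega) hB hAσ hBσ ?_ hpq hpK hpA hpB hqK hqA hqB
  rw [← card_pair hxy.ne]
  exact card_le_card (by simp [insert_subset_iff, hx, hyK])

end MinimalCounterexample

end Cuts

end BipartiteMinors

namespace BipartiteMinors

open Finset
open scoped Classical

/-! ### Vertices of degree four: rows and touching components -/

section DegreeFour

variable {V : Type*}

@[simp] theorem touches_singleton {G : SimpleGraph V} {x l : V} : Touches G {x} l ↔ G.Adj x l := by
  simp [Touches]

theorem exists_not_mem_of_card_lt {s t : Finset V} (h : t.card < s.card) : ∃ x ∈ s, x ∉ t := by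
  by_contra hno
  push Not at hno
  exact absurd (card_le_card (fun x hx => hno x hx : s ⊆ t)) (by omega)

theorem forall_of_card_le_card_filter {s : Finset V} {p : V → Prop}
    (h : s.card ≤ (s.filter p).card) : ∀ x ∈ s, p x := fun x hx => by
  have := eq_of_subset_of_card_le (filter_subset p s) h
  exact (mem_filter.1 (this ▸ hx)).2

/-- Four disjoint connected sets, one of them a single vertex, seeing four common vertices. -/
theorem model_K44Minus_of_rows {G : SimpleGraph V} {v : V} {L X₁ X₂ X₃ : Finset V}
    (hL : L.card = 4) (hv : ∀ l ∈ L, G.Adj v l) (h₁ : Conn G X₁) (h₂ : Conn G X₂)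
    (h₃ : Conn G X₃) (hv₁ : v ∉ X₁) (hv₂ : v ∉ X₂) (hv₃ : v ∉ X₃) (h₁₂ : Disjoint X₁ X₂)
    (h₁₃ : Disjoint X₁ X₃) (h₂₃ : Disjoint X₂ X₃) (hL₁ : Disjoint X₁ L) (hL₂ : Disjoint X₂ L)
    (hL₃ : Disjoint X₃ L) (ht₁ : 4 ≤ (L.filter (Touches G X₁)).card)
    (ht₂ : 4 ≤ (L.filter (Touches G X₂)).card)
    (ht₃ : 3 ≤ (L.filter (Touches G X₃)).card) : Model G K44Minus := by
  have ht₁' := forall_of_card_le_card_filter (s := L) (p := Touches G X₁) (by omega)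
  have ht₂' := forall_of_card_le_card_filter (s := L) (p := Touches G X₂) (by omega)
  obtain ⟨d, hd, hmiss⟩ : ∃ d ∈ L, ∀ l ∈ L, l ≠ d → Touches G X₃ l := by
    have hs := card_filter_add_card_filter_not (s := L) (Touches G X₃)
    rcases (L.filter fun l => ¬ Touches G X₃ l).eq_empty_or_nonempty with he | ⟨d, hd⟩
    · obtain ⟨d, hd⟩ : L.Nonempty := card_pos.1 (by omega)
      refine ⟨d, hd, fun l hl _ => ?_⟩
      by_contra hno
      exact absurd (mem_filter.2 ⟨hl, hno⟩) (by rw [he]; simp)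
    · refine ⟨d, (mem_filter.1 hd).1, fun l hl hne => ?_⟩
      by_contra hno
      exact hne (card_le_one.1 (by omega) l (mem_filter.2 ⟨hl, hno⟩) d hd)
  -- The deleted edge of `K44Minus` joins the vertices of index 0. Hence `X₃` becomes row 0, and the
  -- column it may miss must be numbered 0.
  obtain ⟨e, he⟩ : ∃ e : Fin 4 ≃ L, (e 0 : V) = d := by
    have e₀ : Fin 4 ≃ L := (L.equivFinOfCardEq hL).symm
    refine ⟨(Equiv.swap 0 (e₀.symm ⟨d, hd⟩)).trans e₀, ?_⟩
    simp
  have hvL : v ∉ L := fun hvL => G.loopless.1 v (hv v hvL)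
  refine model_K44Minus ![X₃, {v}, X₁, X₂] (fun j => {(e j : V)}) ?_
    (fun j => conn_singleton _) ?_ ?_ ?_ ?_
  · intro i
    fin_cases i
    exacts [h₃, conn_singleton v, h₁, h₂]
  · intro i j hij
    fin_cases i <;> fin_cases j <;>
      first
      | exact absurd rfl hij
      | simp [hv₁, hv₂, hv₃, h₁₂, h₁₃, h₂₃, h₁₂.symm, h₁₃.symm, h₂₃.symm]
  · intro i j hij
    rw [disjoint_singleton]
    exact fun hh => hij (e.injective (Subtype.ext hh))
  · intro i j
    rw [disjoint_singleton_right]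
    have hej := (e j).2
    fin_cases i
    · exact fun hx => disjoint_left.1 hL₃ hx hej
    · exact fun hx => hvL (mem_singleton.1 hx ▸ hej)
    · exact fun hx => disjoint_left.1 hL₁ hx hej
    · exact fun hx => disjoint_left.1 hL₂ hx hej
  · intro i j hij
    have hej := (e j).2
    suffices ∃ x ∈ (![X₃, {v}, X₁, X₂] : Fin 4 → Finset V) i, G.Adj x (e j) by
      obtain ⟨x, hx, hxy⟩ := this
      exact ⟨x, hx, _, mem_singleton_self _, hxy⟩
    fin_cases i
    · refine hmiss _ hej fun hed => hij ?_
      have : j = 0 := e.injective (Subtype.ext (hed.trans he.symm))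
      simp [this]
    · exact ⟨v, mem_singleton_self v, hv _ hej⟩
    · exact ht₁' _ hej
    · exact ht₂' _ hej

variable [Fintype V]

namespace MinimalCounterexample

variable {G : SimpleGraph V} {c : V → Bool}

theorem color_eq_of_common (h : MinimalCounterexample G c) {x y z : V} (hx : G.Adj x z)
    (hy : G.Adj y z) : c x = c y := by
  rw [← Bool.not_inj_iff, ← h.color_eq_not hx, ← h.color_eq_not hy]

theorem no_rows (h : MinimalCounterexample G c) {v : V} {L X₁ X₂ X₃ : Finset V}
    (hL : L.card = 4) (hv : ∀ l ∈ L, G.Adj v l) (h₁ : Conn G X₁) (h₂ : Conn G X₂)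
    (h₃ : Conn G X₃) (hv₁ : v ∉ X₁) (hv₂ : v ∉ X₂) (hv₃ : v ∉ X₃) (h₁₂ : Disjoint X₁ X₂)
    (h₁₃ : Disjoint X₁ X₃) (h₂₃ : Disjoint X₂ X₃) (hL₁ : Disjoint X₁ L) (hL₂ : Disjoint X₂ L)
    (hL₃ : Disjoint X₃ L) (ht₁ : 4 ≤ (L.filter (Touches G X₁)).card)
    (ht₂ : 4 ≤ (L.filter (Touches G X₂)).card)
    (ht₃ : 3 ≤ (L.filter (Touches G X₃)).card) : False :=
  h.no_K44Minus (model_K44Minus_of_rows hL hv h₁ h₂ h₃ hv₁ hv₂ hv₃ h₁₂ h₁₃ h₂₃ hL₁ hL₂ hL₃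
    ht₁ ht₂ ht₃)

/-- Components after deleting a vertex, its neighbours and two more vertices see four
neighbours. -/
theorem four_le_touches (h : MinimalCounterexample G c) {v : V} {U K : Finset V}
    (hU : U.card ≤ 2) (hUc : ∀ u ∈ U, c u = c v) (hvU : v ∉ U) (hK : Conn G K)
    (hKs : K ⊆ univ \ (insert v U ∪ nb G v))
    (hcl : ∀ x ∈ K, ∀ y ∈ univ \ (insert v U ∪ nb G v), G.Adj x y → y ∈ K) :
    4 ≤ ((nb G v).filter (Touches G K)).card := by
  -- Otherwise the at most three touched neighbours of `v`, together with `U`, separate `K` from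
  -- `v`.
  by_contra hlt
  refine h.no_cut (!(c v)) (A := (nb G v).filter (Touches G K)) (B := U) hK ?_ (by omega) hU
    (fun a ha => h.color_eq_not (mem_nb.1 (mem_filter.1 ha).1)) (by simpa using hUc) (p := v)
    (fun hv => by simpa using hKs hv) (by simp) hvU
  intro x hx y hxy
  by_cases hyN : y ∈ nb G v
  · exact Or.inr (Or.inl (mem_filter.2 ⟨hyN, x, hx, hxy⟩))
  · by_cases hyU : y ∈ U
    · exact Or.inr (Or.inr hyU)
    · by_cases hyv : y = v
      · have := hKs hx
        simp [hyv ▸ hxy.symm] at this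
      · exact Or.inl (hcl x hx y (by simp [hyv, hyU, mem_nb.not.1 hyN]) hxy)

/-- The analogue of `four_le_touches` when a further vertex on the other side is deleted: now
there may also be isolated vertices of degree four. -/
theorem four_le_touches_or (h : MinimalCounterexample G c) {v u : V} {U K : Finset V}
    (hU : U.card ≤ 2) (hUc : ∀ u ∈ U, c u = c v) (hvU : v ∉ U) (hu : c u = !(c v))
    (huN : u ∉ nb G v) (hK : Conn G K)
    (hKs : K ⊆ univ \ (insert v (insert u U) ∪ nb G v))
    (hcl : ∀ x ∈ K, ∀ y ∈ univ \ (insert v (insert u U) ∪ nb G v), G.Adj x y → y ∈ K) :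
    4 ≤ ((nb G v).filter (Touches G K)).card ∨ ∃ w, K = {w} ∧ (nb G w).card = 4 ∧
      (nb G w ∩ nb G v).card = 3 ∧ G.Adj w u := by
  by_contra hcon
  push Not at hcon
  obtain ⟨hlt, hw⟩ := hcon
  -- With `u` added, the cut has up to four vertices of one colour, which `no_edge_cut` still
  -- forbids when `K` has an edge: the edge from `v` to an untouched neighbour is on the other side.
  -- A single vertex `w` of the colour of `v` escapes only if its neighbourhood is all of `A`; one
  -- of the other colour would have its neighbours in `U`, which is too small.
  set A := insert u ((nb G v).filter (Touches G K)) with hA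
  have hcl' : ∀ x ∈ K, ∀ y, G.Adj x y → y ∈ K ∨ y ∈ A ∨ y ∈ U := by
    intro x hx y hxy
    by_cases hyN : y ∈ nb G v
    · exact Or.inr (Or.inl (mem_insert_of_mem (mem_filter.2 ⟨hyN, x, hx, hxy⟩)))
    · by_cases hyU : y ∈ U
      · exact Or.inr (Or.inr hyU)
      · by_cases hyv : y = v
        · have := hKs hx
          simp [hyv ▸ hxy.symm] at this
        · by_cases hyu : y = u
          · exact Or.inr (Or.inl (hyu ▸ mem_insert_self _ _))
          · exact Or.inl (hcl x hx y (by simp [hyv, hyU, hyu, mem_nb.not.1 hyN]) hxy)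
  have hAc : A.card ≤ 4 := (card_insert_le _ _).trans (by omega)
  have hAσ : ∀ a ∈ A, c a = !(c v) := by
    intro a ha
    rcases mem_insert.1 ha with rfl | ha
    · exact hu
    · exact h.color_eq_not (mem_nb.1 (mem_filter.1 ha).1)
  by_cases hK2 : 2 ≤ K.card
  · obtain ⟨q, hqN, hq⟩ := exists_not_mem_of_card_lt (lt_of_lt_of_le hlt (h.four_le_degree v))
    have hqu : q ≠ u := fun hqu => huN (hqu ▸ hqN)
    refine h.no_edge_cut (!(c v)) (B := U) hK hcl' hAc hU hAσ (by simpa using hUc)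
      hK2 (p := v) (q := q) (mem_nb.1 hqN)
      (fun hv => by simpa using hKs hv) ?_ hvU (fun hqK => ?_) ?_ ?_
    · simp only [hA, mem_insert, mem_filter, mem_nb, not_or]
      exact ⟨fun hvu => by simp [hvu] at hu, fun hvv => G.loopless.1 v hvv.1⟩
    · have := hKs hqK
      simp [mem_nb.1 hqN] at this
    · simp only [hA, mem_insert, not_or]
      exact ⟨hqu, hq⟩
    · intro hqU
      exact h.proper v q (mem_nb.1 hqN) (hUc q hqU).symm
  · obtain ⟨w, rfl⟩ := card_eq_one.1 (le_antisymm (by omega) (card_pos.2 hK.1))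
    have hnw : ∀ y, G.Adj w y → y ∈ A ∨ y ∈ U := fun y hy =>
      (hcl' w (mem_singleton_self w) y hy).resolve_left fun hyw =>
        hy.ne (mem_singleton.1 hyw).symm
    have h4 := h.four_le_degree w
    by_cases hcw : c w = c v
    · have hwA : nb G w ⊆ A := fun y hy => (hnw y (mem_nb.1 hy)).resolve_right fun hyU =>
        h.proper w y (mem_nb.1 hy) (hcw.trans (hUc y hyU).symm)
      have hwA' : nb G w = A := eq_of_subset_of_card_le hwA (by omega)
      refine hw w rfl (by rw [hwA'] at h4 ⊢; omega) ?_ (mem_nb.1 (hwA' ▸ mem_insert_self _ _))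
      have huF : u ∉ (nb G v).filter (Touches G {w}) := fun hu => huN (mem_filter.1 hu).1
      have : nb G w ∩ nb G v = (nb G v).filter (Touches G {w}) := by
        ext y
        simp [and_comm]
      rw [this]
      have hAc' : A.card = ((nb G v).filter (Touches G {w})).card + 1 :=
        card_insert_of_notMem huF
      rw [hwA'] at h4
      omega
    · have : nb G w ⊆ U := fun y hy => (hnw y (mem_nb.1 hy)).resolve_left fun hyA => by
        have h1 := h.color_eq_not (mem_nb.1 hy)
        rw [hAσ y hyA, Bool.not_inj_iff] at h1
        exact hcw h1.symm
      have := card_le_card this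
      omega

theorem filter_touches_singleton {v x : V} :
    (nb G v).filter (Touches G {x}) = nb G x ∩ nb G v := by
  ext y
  simp [and_comm]

theorem color_eq_of_inter (h : MinimalCounterexample G c) {v x : V}
    (hx : 0 < (nb G x ∩ nb G v).card) : c x = c v := by
  obtain ⟨z, hz⟩ := card_pos.1 hx
  rw [mem_inter, mem_nb, mem_nb] at hz
  exact h.color_eq_of_common hz.1 hz.2

theorem notMem_nb_of_color_eq (h : MinimalCounterexample G c) {v x : V} (hx : c x = c v) :
    x ∉ nb G v := fun hv => h.proper v x (mem_nb.1 hv) hx.symm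

/-- A vertex of degree four has no full twin besides a vertex seeing three of its neighbours. -/
theorem no_full_and_three (h : MinimalCounterexample G c) {v x y : V} (hv : (nb G v).card = 4)
    (hxv : x ≠ v) (hyv : y ≠ v) (hxy : x ≠ y) (hx : 3 ≤ (nb G x ∩ nb G v).card)
    (hy : 4 ≤ (nb G y ∩ nb G v).card) : False := by
  have hcx := h.color_eq_of_inter (by omega : 0 < (nb G x ∩ nb G v).card)
  have hcy := h.color_eq_of_inter (by omega : 0 < (nb G y ∩ nb G v).card)
  -- The class of `v` has a vertex outside `v`, `x`, `y`; its component in the remaining graph is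
  -- the missing full row.
  obtain ⟨z, hz, hz'⟩ : ∃ z ∈ univ.filter (fun z => c z = c v), z ∉ ({v, x, y} : Finset V) :=
    exists_not_mem_of_card_lt (lt_of_le_of_lt card_le_three (by have := h.parts (c v); omega))
  have hcz := (mem_filter.1 hz).2
  simp only [mem_insert, mem_singleton, not_or] at hz'
  obtain ⟨K, hKs, -, hK, hcl⟩ := exists_component (G := G)
    (univ \ (insert v {x, y} ∪ nb G v)) (x₀ := z)
    (by simp only [mem_sdiff, mem_univ, true_and, mem_union, mem_insert, mem_singleton, not_or]
        exact ⟨hz', h.notMem_nb_of_color_eq hcz⟩)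
  have h4 := h.four_le_touches (v := v) (U := {x, y}) card_le_two (by simp [hcx, hcy])
    (by simp [hxv.symm, hyv.symm]) hK hKs hcl
  have hKd : ∀ u ∈ K, u ≠ v ∧ u ≠ x ∧ u ≠ y ∧ u ∉ nb G v := fun u hu => by
    have := hKs hu
    simp only [mem_sdiff, mem_univ, true_and, mem_union, mem_insert, mem_singleton, not_or] at this
    tauto
  refine h.no_rows (v := v) (L := nb G v) (X₁ := K) (X₂ := {y}) (X₃ := {x}) hv
    (fun l hl => mem_nb.1 hl) hK (conn_singleton y) (conn_singleton x)
    (fun hvK => (hKd v hvK).1 rfl) (by simpa using hyv.symm) (by simpa using hxv.symm)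
    ?_ ?_ (by simpa using hxy.symm) ?_ ?_ ?_ h4 ?_ ?_
  · simpa using fun hyK => (hKd y hyK).2.2.1 rfl
  · simpa using fun hxK => (hKd x hxK).2.1 rfl
  · exact disjoint_left.2 fun u hu => (hKd u hu).2.2.2
  · rw [disjoint_singleton_left]; exact h.notMem_nb_of_color_eq hcy
  · rw [disjoint_singleton_left]; exact h.notMem_nb_of_color_eq hcx
  · rwa [filter_touches_singleton]
  · rwa [filter_touches_singleton]

/-- No three vertices of degree four have three common neighbours. -/
theorem no_three_twins (h : MinimalCounterexample G c) {v₁ v₂ v₃ : V} {T : Finset V}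
    (h₁₂ : v₁ ≠ v₂) (h₁₃ : v₁ ≠ v₃) (h₂₃ : v₂ ≠ v₃) (hT : T.card = 3)
    (hd : ∀ w ∈ ({v₁, v₂, v₃} : Finset V), (nb G w).card = 4 ∧ T ⊆ nb G w) : False := by
  obtain ⟨a, b, e, hab, hae, hbe, hTe⟩ := card_eq_three.1 hT
  have hd₁ := hd v₁ (by simp)
  have haT : a ∈ T := by simp [hTe]
  have hbT : b ∈ T := by simp [hTe]
  have heT : e ∈ T := by simp [hTe]
  have hTv : ∀ w ∈ ({v₁, v₂, v₃} : Finset V), ∀ t ∈ T, G.Adj w t := fun w hw t ht =>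
    mem_nb.1 ((hd w hw).2 ht)
  have h8 := h.eight_le hab (hTv v₁ (by simp) a haT) (hTv v₁ (by simp) b hbT)
  -- `a` and `b` have at least 8-4 common neighbours, hence one besides the three twins. It is the
  -- fourth row, and its possible non-adjacency to `e` is the missing edge.
  obtain ⟨x, hx, hxW⟩ : ∃ x ∈ nb G a ∩ nb G b, x ∉ ({v₁, v₂, v₃} : Finset V) :=
    exists_not_mem_of_card_lt (lt_of_le_of_lt card_le_three (by omega))
  rw [mem_inter, mem_nb, mem_nb] at hx
  have hcW : ∀ w ∈ ({v₁, v₂, v₃} : Finset V), c w = c x := fun w hw =>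
    h.color_eq_of_common (hTv w hw a haT) hx.1.symm
  have hcT : ∀ t ∈ T, c t = !(c x) := fun t ht => by
    rw [← hcW v₁ (by simp)]; exact h.color_eq_not (hTv v₁ (by simp) t ht)
  have hne : ∀ {y z : V}, c y = c x → c z = !(c x) → y ≠ z := by
    rintro y z hy hz rfl
    simp [hy] at hz
  -- All remaining vertices form the fourth column. Removing `x` and `T` leaves a connected graph by
  -- `no_cut`. In it each twin has only its one neighbour outside `T`, so the twins can be dropped
  -- as leaves.
  set s := univ \ (insert x T) with hs
  have hpre : Preconn G s := by
    by_contra hno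
    obtain ⟨K, L, hKs, hLs, hKL, hK, hL, hKcl, -⟩ := exists_two_components hno
    obtain ⟨p, hp⟩ := hL.1
    have hps := hLs hp
    simp only [hs, mem_sdiff, mem_univ, true_and, mem_insert, not_or] at hps
    refine h.no_cut (!(c x)) (A := T) (B := {x}) hK (fun u hu y huy => ?_) hT.le (by simp) hcT
      (by simp) (fun hpK => disjoint_left.1 hKL hpK hp) hps.2 (by simpa using hps.1)
    by_cases hy : y ∈ s
    · exact Or.inl (hKcl u hu y hy huy)
    · simp only [hs, mem_sdiff, mem_univ, true_and, not_not, mem_insert] at hy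
      simpa using Or.inr hy.symm
  set Γ := s \ {v₁, v₂, v₃} with hΓ
  have hΓpre : Preconn G Γ := by
    refine hpre.sdiff_leaves fun w hw _ y hy z hz hwy hwz => ?_
    have h1 : (nb G w \ T).card = 1 := by
      rw [card_sdiff_of_subset (hd w hw).2, (hd w hw).1, hT]
    simp only [hs, mem_sdiff, mem_univ, true_and, mem_insert, not_or] at hy hz
    exact card_le_one.1 h1.le y (by simp [hwy, hy.2]) z (by simp [hwz, hz.2])
  have hΓadj : ∀ w, c w = c x → ∃ y ∈ Γ, G.Adj w y := by
    intro w hw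
    obtain ⟨y, hy, hyT⟩ := exists_not_mem_of_card_lt
      (lt_of_lt_of_le (by omega : T.card < 4) (h.four_le_degree w))
    rw [mem_nb] at hy
    have hcy : c y = !(c x) := by rw [h.color_eq_not hy, hw]
    refine ⟨y, ?_, hy⟩
    rw [hΓ, mem_sdiff, hs, mem_sdiff, mem_insert, not_or]
    exact ⟨⟨mem_univ _, (hne rfl hcy).symm, hyT⟩, fun hyW => hne (hcW y hyW) hcy rfl⟩
  have hΓne : Γ.Nonempty := let ⟨y, hy, _⟩ := hΓadj x rfl; ⟨y, hy⟩
  have hΓT : ∀ t ∈ T, t ∉ Γ := fun t ht => by simp [hΓ, hs, ht]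
  have hΓW : ∀ w ∈ ({v₁, v₂, v₃} : Finset V), w ∉ Γ := fun w hw hwΓ => (mem_sdiff.1 hwΓ).2 hw
  have hxΓ : x ∉ Γ := by simp [hΓ, hs]
  simp only [mem_insert, mem_singleton, not_or] at hxW
  let r : Fin 4 → V := ![x, v₁, v₂, v₃]
  have hr : ∀ i, c (r i) = c x := by
    intro i
    fin_cases i
    exacts [rfl, hcW v₁ (by simp), hcW v₂ (by simp), hcW v₃ (by simp)]
  have hrΓ : ∀ i, r i ∉ Γ := by
    intro i
    fin_cases i
    exacts [hxΓ, hΓW v₁ (by simp), hΓW v₂ (by simp), hΓW v₃ (by simp)]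
  refine h.no_K44Minus (model_K44Minus (fun i => {r i}) ![{e}, {a}, {b}, Γ]
    (fun i => conn_singleton _) ?_ ?_ ?_ ?_ ?_)
  · intro i
    fin_cases i
    exacts [conn_singleton e, conn_singleton a, conn_singleton b, ⟨hΓne, hΓpre⟩]
  · intro i j hij
    rw [disjoint_singleton]
    fin_cases i <;> fin_cases j <;>
      first
      | exact absurd rfl hij
      | simp [r, hxW, h₁₂, h₁₃, h₂₃, h₁₂.symm, h₁₃.symm, h₂₃.symm, Ne.symm hxW.1,
          Ne.symm hxW.2.1, Ne.symm hxW.2.2]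
  · intro i j hij
    fin_cases i <;> fin_cases j <;>
      first
      | exact absurd rfl hij
      | simp [hab, hae, hbe, hab.symm, hae.symm, hbe.symm, hΓT a haT, hΓT b hbT, hΓT e heT]
  · intro i j
    rw [disjoint_singleton_left]
    fin_cases j
    · simpa using hne (hr i) (hcT e heT)
    · simpa using hne (hr i) (hcT a haT)
    · simpa using hne (hr i) (hcT b hbT)
    · exact hrΓ i
  · intro i j hij
    refine ⟨r i, mem_singleton_self _, ?_⟩
    fin_cases j
    · fin_cases i
      · exact absurd rfl hij
      all_goals exact ⟨e, mem_singleton_self e, hTv _ (by simp [r]) e heT⟩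
    · refine ⟨a, mem_singleton_self a, ?_⟩
      fin_cases i
      · exact hx.1.symm
      all_goals exact hTv _ (by simp [r]) a haT
    · refine ⟨b, mem_singleton_self b, ?_⟩
      fin_cases i
      · exact hx.2.symm
      all_goals exact hTv _ (by simp [r]) b hbT
    · exact hΓadj _ (hr i)

end MinimalCounterexample

end DegreeFour

end BipartiteMinors

namespace BipartiteMinors

open Finset
open scoped Classical

/-! ### Vertices of degree four: splitting the remaining graph into two rows -/

section DegreeFour

variable {V : Type*} [Fintype V]

namespace MinimalCounterexample

variable {G : SimpleGraph V} {c : V → Bool}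

/-- Two neighbours of a vertex of degree four have a common neighbour outside a given triple. -/
theorem exists_common (h : MinimalCounterexample G c) {v a b : V} (hv : (nb G v).card = 4)
    (hab : a ≠ b) (ha : a ∈ nb G v) (hb : b ∈ nb G v) {X : Finset V} (hX : X.card ≤ 3) :
    ∃ g, G.Adj g a ∧ G.Adj g b ∧ g ∉ X ∧ c g = c v := by
  have h8 := h.eight_le hab (mem_nb.1 ha) (mem_nb.1 hb)
  obtain ⟨g, hg, hgX⟩ := exists_not_mem_of_card_lt
    (lt_of_le_of_lt hX (by omega : 3 < (nb G a ∩ nb G b).card))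
  rw [mem_inter, mem_nb, mem_nb] at hg
  exact ⟨g, hg.1.symm, hg.2.symm, hgX, h.color_eq_of_common hg.1.symm (mem_nb.1 ha)⟩

/-- A vertex of degree four has no full twin. -/
theorem no_full (h : MinimalCounterexample G c) {v y : V} (hv : (nb G v).card = 4)
    (hyv : y ≠ v) (hy : 4 ≤ (nb G y ∩ nb G v).card) : False := by
  have hcy := h.color_eq_of_inter (by omega : 0 < (nb G y ∩ nb G v).card)
  -- This bound rules out the exceptional single-vertex components of `four_le_touches_or` below.
  have hlab : ∀ x, x ≠ v → x ≠ y → (nb G x ∩ nb G v).card ≤ 2 := fun x hxv hxy => by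
    by_contra hx
    exact h.no_full_and_three hv hxv hyv hxy (by omega) hy
  have hyN := h.notMem_nb_of_color_eq hcy
  set D := univ \ (insert v {y} ∪ nb G v) with hD
  have hmemD : ∀ z, z ∈ D ↔ z ≠ v ∧ z ≠ y ∧ z ∉ nb G v := fun z => by
    simp only [hD, mem_sdiff, mem_univ, true_and, mem_union, mem_insert, mem_singleton, not_or,
      and_assoc]
  have hrows : ∀ K L : Finset V, K ⊆ D → L ⊆ D → Disjoint K L → Conn G K → Conn G L →
      4 ≤ ((nb G v).filter (Touches G K)).card → 3 ≤ ((nb G v).filter (Touches G L)).card →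
      False := by
    intro K L hK hL hKL hKc hLc hKt hLt
    refine h.no_rows (v := v) (L := nb G v) (X₁ := {y}) (X₂ := K) (X₃ := L) hv
      (fun l hl => mem_nb.1 hl) (conn_singleton y) hKc hLc (by simpa using hyv.symm)
      (fun hvK => ((hmemD v).1 (hK hvK)).1 rfl) (fun hvL => ((hmemD v).1 (hL hvL)).1 rfl)
      (by simpa using fun hyK => ((hmemD y).1 (hK hyK)).2.1 rfl)
      (by simpa using fun hyL => ((hmemD y).1 (hL hyL)).2.1 rfl) hKL
      (by rwa [disjoint_singleton_left]) (disjoint_left.2 fun z hz => ((hmemD z).1 (hK hz)).2.2)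
      (disjoint_left.2 fun z hz => ((hmemD z).1 (hL hz)).2.2) ?_ hKt hLt
    rwa [filter_touches_singleton]
  have hDpre : Preconn G D := by
    by_contra hno
    obtain ⟨K, L, hKs, hLs, hKL, hK, hL, hKcl, hLcl⟩ := exists_two_components hno
    have hK4 := h.four_le_touches (v := v) (U := {y}) (by simp) (by simp [hcy])
      (by simpa using hyv.symm) hK hKs hKcl
    have hL4 := h.four_le_touches (v := v) (U := {y}) (by simp) (by simp [hcy])
      (by simpa using hyv.symm) hL hLs hLcl
    exact hrows K L hKs hLs hKL hK hL hK4 (by omega)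
  have hD1 : ∀ t ∈ D, Preconn G (D.erase t) := by
    intro t ht
    have htD := (hmemD t).1 ht
    by_contra hno
    obtain ⟨K, L, hKs, hLs, hKL, hK, hL, hKcl, hLcl⟩ := exists_two_components hno
    have hfull : ∀ K : Finset V, K ⊆ D.erase t → Conn G K →
        (∀ x ∈ K, ∀ y ∈ D.erase t, G.Adj x y → y ∈ K) →
        4 ≤ ((nb G v).filter (Touches G K)).card := by
      intro K hKs hK hKcl
      by_cases hct : c t = c v
      · have hset : D.erase t = univ \ (insert v {y, t} ∪ nb G v) := by
          ext z
          simp only [mem_erase, hmemD, mem_sdiff, mem_univ, true_and, mem_union, mem_insert,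
            mem_singleton, not_or]
          tauto
        rw [hset] at hKs hKcl
        exact h.four_le_touches (U := {y, t}) card_le_two (by simp [hcy, hct])
          (by simp [hyv.symm, htD.1.symm]) hK hKs hKcl
      · have hset : D.erase t = univ \ (insert v (insert t {y}) ∪ nb G v) := by
          ext z
          simp only [mem_erase, hmemD, mem_sdiff, mem_univ, true_and, mem_union, mem_insert,
            mem_singleton, not_or]
          tauto
        rw [hset] at hKs hKcl
        rcases h.four_le_touches_or (u := t) (U := {y}) (by simp) (by simp [hcy])
          (by simpa using hyv.symm) (by revert hct; cases c t <;> cases c v <;> simp)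
          htD.2.2 hK hKs hKcl with h4 | ⟨w, rfl, -, hw, -⟩
        · exact h4
        · rw [← hset, singleton_subset_iff, mem_erase, hmemD] at hKs
          have := hlab w hKs.2.1 hKs.2.2.1
          omega
    exact hrows K L (hKs.trans (erase_subset _ _)) (hLs.trans (erase_subset _ _)) hKL hK hL
      (hfull K hKs hK hKcl) (by have := hfull L hLs hL hLcl; omega)
  -- `P` sees at most two neighbours of `v`, while `P` with `t` sees at least three. Every `l` in
  -- N(v) has a partner `l'` such that `P` does not see both, and a common neighbour of `l` and `l'`
  -- other than `v`, `y`, `t` then lies in the remainder `Q`. So `Q` sees all of N(v), and the rows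
  -- are `v`, `y`, `Q` and `P` with `t`.
  obtain ⟨P, hPD, t, htD, htP, hconn, hpre, hP, hPt⟩ := exists_growth hDpre hD1
    (fun P => 3 ≤ ((nb G v).filter (Touches G P)).card) (fun hh => by
      rw [filter_false_of_mem (by simp [Touches])] at hh
      simp at hh) (by
      rw [filter_true_of_mem, hv]
      · omega
      intro l hl
      obtain ⟨l', hl', hne⟩ : ∃ l' ∈ nb G v, l' ∉ ({l} : Finset V) :=
        exists_not_mem_of_card_lt (by rw [hv]; simp)
      obtain ⟨g, hgl, -, hg, hcg⟩ := h.exists_common hv (X := {v, y})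
        (Ne.symm (by simpa using hne)) hl hl' (card_le_two.trans (by omega))
      simp only [mem_insert, mem_singleton, not_or] at hg
      exact ⟨g, (hmemD g).2 ⟨hg.1, hg.2, h.notMem_nb_of_color_eq hcg⟩, hgl⟩)
  set Q := (D \ P).erase t with hQ
  have hQD : Q ⊆ D := (erase_subset _ _).trans sdiff_subset
  have hQt : ∀ l ∈ nb G v, Touches G Q l := by
    intro l hl
    obtain ⟨l', hl', hne, hmiss⟩ : ∃ l' ∈ nb G v, l ≠ l' ∧ ¬ (Touches G P l ∧ Touches G P l') := by
      by_cases hlP : Touches G P l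
      · obtain ⟨l', hl', hlF⟩ : ∃ l' ∈ nb G v, l' ∉ (nb G v).filter (Touches G P) :=
          exists_not_mem_of_card_lt (by omega)
        have hl'P : ¬ Touches G P l' := fun hh => hlF (mem_filter.2 ⟨hl', hh⟩)
        exact ⟨l', hl', fun hll => hl'P (hll ▸ hlP), fun hh => hl'P hh.2⟩
      · obtain ⟨l', hl', hne⟩ : ∃ l' ∈ nb G v, l' ∉ ({l} : Finset V) :=
          exists_not_mem_of_card_lt (by rw [hv]; simp)
        exact ⟨l', hl', Ne.symm (by simpa using hne), fun hh => hlP hh.1⟩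
    obtain ⟨g, hgl, hgl', hg, hcg⟩ := h.exists_common hv (X := {v, y, t}) hne hl hl' card_le_three
    simp only [mem_insert, mem_singleton, not_or] at hg
    refine ⟨g, mem_erase.2 ⟨hg.2.2, mem_sdiff.2
      ⟨(hmemD g).2 ⟨hg.1, hg.2.1, h.notMem_nb_of_color_eq hcg⟩, fun hgP => ?_⟩⟩, hgl⟩
    exact hmiss ⟨⟨g, hgP, hgl⟩, ⟨g, hgP, hgl'⟩⟩
  have hQne : Q.Nonempty := by
    obtain ⟨l, hl⟩ : (nb G v).Nonempty := card_pos.1 (by omega)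
    obtain ⟨g, hg, -⟩ := hQt l hl
    exact ⟨g, hg⟩
  refine hrows Q (insert t P) hQD (insert_subset htD hPD) ?_ ⟨hQne, hpre⟩ hconn ?_ hPt
  · rw [disjoint_left]
    intro z hz hz'
    rw [hQ, mem_erase, mem_sdiff] at hz
    exact (mem_insert.1 hz').elim hz.1 hz.2.2
  · rw [filter_true_of_mem hQt, hv]

/-- A vertex of degree four sharing three neighbours with `v` has a unique further neighbour. -/
theorem exists_outer_neighbor {v w : V} (hw : (nb G w).card = 4)
    (hwv : (nb G w ∩ nb G v).card = 3) :
    ∃ u, G.Adj w u ∧ u ∉ nb G v ∧ ∀ y, G.Adj w y → y ∉ nb G v → y = u := by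
  have h1 : (nb G w \ nb G v).card = 1 := by
    have := card_sdiff_add_card_inter (nb G w) (nb G v)
    omega
  obtain ⟨u, hu⟩ := card_eq_one.1 h1
  have hu' : u ∈ nb G w \ nb G v := hu ▸ mem_singleton_self u
  rw [mem_sdiff, mem_nb] at hu'
  refine ⟨u, hu'.1, hu'.2, fun y hy hyv => ?_⟩
  have : y ∈ nb G w \ nb G v := mem_sdiff.2 ⟨mem_nb.2 hy, hyv⟩
  rwa [hu, mem_singleton] at this

/-- With `v` and `x` as rows, two disjoint connected sets that both see all of N(v) are needed. The
obstacle is the set `W` of other degree-four vertices sharing three neighbours with `v`: each is a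
leaf of the remaining graph and becomes isolated when its outer neighbour is deleted. The hypothesis
`hchoice` allows two ways to control them: if `x` itself has degree four, `no_three_twins` bounds
their number; otherwise there are none. -/
theorem no_three_of_choice (h : MinimalCounterexample G c) {v x : V} (hv : (nb G v).card = 4)
    (hxv : x ≠ v) (hx : (nb G x ∩ nb G v).card = 3)
    (hchoice : (nb G x).card = 4 ∨
      ∀ w, w ≠ v → (nb G w ∩ nb G v).card = 3 → (nb G w).card ≠ 4) : False := by
  have hcx := h.color_eq_of_inter (by omega : 0 < (nb G x ∩ nb G v).card)
  have hxN := h.notMem_nb_of_color_eq hcx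
  set R := univ \ (insert v {x} ∪ nb G v) with hR
  have hmemR : ∀ z, z ∈ R ↔ z ≠ v ∧ z ≠ x ∧ z ∉ nb G v := fun z => by
    simp only [hR, mem_sdiff, mem_univ, true_and, mem_union, mem_insert, mem_singleton, not_or,
      and_assoc]
  have hrows : ∀ K L : Finset V, K ⊆ R → L ⊆ R → Disjoint K L → Conn G K → Conn G L →
      4 ≤ ((nb G v).filter (Touches G K)).card → 4 ≤ ((nb G v).filter (Touches G L)).card →
      False := by
    intro K L hK hL hKL hKc hLc hKt hLt
    refine h.no_rows (v := v) (L := nb G v) (X₁ := K) (X₂ := L) (X₃ := {x}) hv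
      (fun l hl => mem_nb.1 hl) hKc hLc (conn_singleton x)
      (fun hvK => ((hmemR v).1 (hK hvK)).1 rfl) (fun hvL => ((hmemR v).1 (hL hvL)).1 rfl)
      (by simpa using hxv.symm) hKL
      (by simpa using fun hxK => ((hmemR x).1 (hK hxK)).2.1 rfl)
      (by simpa using fun hxL => ((hmemR x).1 (hL hxL)).2.1 rfl)
      (disjoint_left.2 fun z hz => ((hmemR z).1 (hK hz)).2.2)
      (disjoint_left.2 fun z hz => ((hmemR z).1 (hL hz)).2.2)
      (by rwa [disjoint_singleton_left]) hKt hLt ?_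
    rw [filter_touches_singleton, hx]
  -- the isolated vertices that can appear after deleting one more vertex
  set W := univ.filter fun w => w ≠ v ∧ w ≠ x ∧ (nb G w).card = 4 ∧
    (nb G w ∩ nb G v).card = 3 with hW
  have hmemW : ∀ w, w ∈ W ↔ w ≠ v ∧ w ≠ x ∧ (nb G w).card = 4 ∧ (nb G w ∩ nb G v).card = 3 :=
    fun w => by simp [hW]
  have hcW : ∀ w ∈ W, c w = c v := fun w hw =>
    h.color_eq_of_inter (by rw [((hmemW w).1 hw).2.2.2]; omega)
  have hWR : W ⊆ R := fun w hw => (hmemR w).2 ⟨((hmemW w).1 hw).1, ((hmemW w).1 hw).2.1,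
    h.notMem_nb_of_color_eq (hcW w hw)⟩
  have hout : ∀ w ∈ W, ∃ u, G.Adj w u ∧ u ∉ nb G v ∧ ∀ y, G.Adj w y → y ∉ nb G v → y = u :=
    fun w hw => exists_outer_neighbor ((hmemW w).1 hw).2.2.1 ((hmemW w).1 hw).2.2.2
  have huniq : ∀ w ∈ W, ∀ y z, y ∈ R → z ∈ R → G.Adj w y → G.Adj w z → y = z := by
    intro w hw y z hy hz hwy hwz
    obtain ⟨u, -, -, hu⟩ := hout w hw
    rw [hu y hwy ((hmemR y).1 hy).2.2, hu z hwz ((hmemR z).1 hz).2.2]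
  set R₀ := R \ W with hR₀
  have hR₀R : R₀ ⊆ R := sdiff_subset
  have hR₀pre : Preconn G R₀ := by
    refine Preconn.sdiff_leaves ?_ fun w hw _ y hy z hz => huniq w hw y z hy hz
    by_contra hno
    obtain ⟨K, L, hKs, hLs, hKL, hK, hL, hKcl, hLcl⟩ := exists_two_components hno
    exact hrows K L hKs hLs hKL hK hL
      (h.four_le_touches (v := v) (U := {x}) (by simp) (by simp [hcx])
        (by simpa using hxv.symm) hK hKs hKcl)
      (h.four_le_touches (v := v) (U := {x}) (by simp) (by simp [hcx])
        (by simpa using hxv.symm) hL hLs hLcl)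
  have hR₀1 : ∀ t ∈ R₀, Preconn G (R₀.erase t) := by
    intro t ht
    have htR := (hmemR t).1 (hR₀R ht)
    -- Members of `W` adjacent to `t` are isolated once `t` is gone. Leaving them out removes the
    -- exceptional components of `four_le_touches_or`.
    set M := (R.erase t) \ W.filter (fun w => G.Adj w t) with hM
    have hMR : M ⊆ R := sdiff_subset.trans (erase_subset _ _)
    have hset : R₀.erase t = M \ W := by
      ext z
      simp only [hR₀, hM, mem_erase, mem_sdiff, mem_filter]
      tauto
    rw [hset]
    refine Preconn.sdiff_leaves ?_ fun w hw _ y hy z hz => huniq w hw y z (hMR hy) (hMR hz)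
    by_contra hno
    obtain ⟨K, L, hKs, hLs, hKL, hK, hL, hKcl, hLcl⟩ := exists_two_components hno
    have hfull : ∀ K : Finset V, K ⊆ M → Conn G K →
        (∀ x ∈ K, ∀ y ∈ M, G.Adj x y → y ∈ K) →
        4 ≤ ((nb G v).filter (Touches G K)).card := by
      intro K hKM hK hKcl
      have hKs : K ⊆ R.erase t := hKM.trans sdiff_subset
      have hKcl' : ∀ x ∈ K, ∀ y ∈ R.erase t, G.Adj x y → y ∈ K := by
        intro y hy z hz hyz
        refine hKcl y hy z (mem_sdiff.2 ⟨hz, fun hzW => ?_⟩) hyz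
        rw [mem_filter] at hzW
        exact (mem_erase.1 (hKs hy)).1
          (huniq z hzW.1 y t (mem_erase.1 (hKs hy)).2 (hR₀R ht) hyz.symm hzW.2)
      by_cases hct : c t = c v
      · have hset : R.erase t = univ \ (insert v {x, t} ∪ nb G v) := by
          ext z
          simp only [mem_erase, hmemR, mem_sdiff, mem_univ, true_and, mem_union, mem_insert,
            mem_singleton, not_or]
          tauto
        rw [hset] at hKs hKcl'
        exact h.four_le_touches (U := {x, t}) card_le_two (by simp [hcx, hct])
          (by simp [hxv.symm, htR.1.symm]) hK hKs hKcl'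
      · have hset : R.erase t = univ \ (insert v (insert t {x}) ∪ nb G v) := by
          ext z
          simp only [mem_erase, hmemR, mem_sdiff, mem_univ, true_and, mem_union, mem_insert,
            mem_singleton, not_or]
          tauto
        rw [hset] at hKs hKcl'
        rcases h.four_le_touches_or (u := t) (U := {x}) (by simp) (by simp [hcx])
          (by simpa using hxv.symm) (by revert hct; cases c t <;> cases c v <;> simp)
          htR.2.2 hK hKs hKcl' with h4 | ⟨w, rfl, hw4, hw3, hwt⟩
        · exact h4
        · rw [singleton_subset_iff] at hKM
          have hwR := (hmemR w).1 (hMR hKM)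
          exact absurd (mem_filter.2 ⟨(hmemW w).2 ⟨hwR.1, hwR.2.1, hw4, hw3⟩, hwt⟩)
            (mem_sdiff.1 hKM).2
    exact hrows K L (hKs.trans hMR) (hLs.trans hMR) hKL hK hL
      (hfull K hKs hK hKcl) (hfull L hLs hL hLcl)
  -- The leaves in `W` hanging at `P`. As each has only one neighbour in `R`, disjoint subsets of
  -- `R₀` have disjoint sets of leaves, so the growth can run in `R₀` with the leaves attached
  -- afterwards.
  let pe : Finset V → Finset V := fun P => W.filter fun w => ∃ u ∈ P, G.Adj u w
  have hpeW : ∀ P, pe P ⊆ W := fun P => filter_subset _ _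
  have houtR : ∀ w ∈ W, ∃ u ∈ R₀, G.Adj u w := by
    intro w hw
    obtain ⟨u, hwu, huN, -⟩ := hout w hw
    have hcu : c u = !(c v) := by rw [← hcW w hw]; exact h.color_eq_not hwu
    have hne : ∀ z, c z = c v → u ≠ z := by
      rintro z hz rfl
      simp [hz] at hcu
    exact ⟨u, mem_sdiff.2 ⟨(hmemR u).2 ⟨hne v rfl, hne x hcx, huN⟩, fun huW =>
      hne u (hcW u huW) rfl⟩, hwu.symm⟩
  obtain ⟨P, hPR, t, htR₀, htP, hconn, hpre, hP, hPt⟩ := exists_growth hR₀pre hR₀1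
    (fun P => 4 ≤ ((nb G v).filter (Touches G (P ∪ pe P))).card) (fun hh => by
      rw [filter_false_of_mem (by simp [Touches, pe])] at hh
      simp at hh) (by
      rw [filter_true_of_mem, hv]
      intro l hl
      obtain ⟨l', hl', hne⟩ : ∃ l' ∈ nb G v, l' ∉ ({l} : Finset V) :=
        exists_not_mem_of_card_lt (by rw [hv]; simp)
      obtain ⟨g, hgl, -, hg, hcg⟩ := h.exists_common hv (X := {v, x})
        (Ne.symm (by simpa using hne)) hl hl' (card_le_two.trans (by omega))
      simp only [mem_insert, mem_singleton, not_or] at hg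
      refine ⟨g, ?_, hgl⟩
      have hgR : g ∈ R := (hmemR g).2 ⟨hg.1, hg.2, h.notMem_nb_of_color_eq hcg⟩
      by_cases hgW : g ∈ W
      · exact mem_union_right _ (mem_filter.2 ⟨hgW, houtR g hgW⟩)
      · exact mem_union_left _ (mem_sdiff.2 ⟨hgR, hgW⟩))
  obtain ⟨d, hdN, hd⟩ : ∃ d ∈ nb G v, ¬ Touches G (P ∪ pe P) d := by
    obtain ⟨d, hdN, hd⟩ : ∃ d ∈ nb G v, d ∉ (nb G v).filter (Touches G (P ∪ pe P)) :=
      exists_not_mem_of_card_lt (by omega)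
    exact ⟨d, hdN, fun hh => hd (mem_filter.2 ⟨hdN, hh⟩)⟩
  set Q := (R₀ \ P).erase t with hQ
  have hQR₀ : Q ⊆ R₀ := (erase_subset _ _).trans sdiff_subset
  have hmemQ : ∀ z, z ∈ R₀ → z ≠ t → z ∉ P → z ∈ Q := fun z hz hzt hzP =>
    mem_erase.2 ⟨hzt, mem_sdiff.2 ⟨hz, hzP⟩⟩
  -- `d` is seen neither by `P` nor by its leaves, so a common neighbour of `a` and `d` in `R` lies
  -- in `Q`, hangs at `Q`, equals `t` or hangs at `t`. If `t` has the colour of `v`, it suffices to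
  -- avoid `t` itself; otherwise it suffices to avoid `W`.
  have hpair : ∀ a ∈ nb G v, a ≠ d → ∃ g ∈ Q ∪ pe Q, G.Adj g a ∧ G.Adj g d := by
    intro a ha had
    by_cases hct : c t = c v
    · obtain ⟨g, hga, hgd, hg, hcg⟩ := h.exists_common hv (X := {v, x, t}) had ha hdN
        card_le_three
      simp only [mem_insert, mem_singleton, not_or] at hg
      have hgR : g ∈ R := (hmemR g).2 ⟨hg.1, hg.2.1, h.notMem_nb_of_color_eq hcg⟩
      refine ⟨g, ?_, hga, hgd⟩
      by_cases hgW : g ∈ W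
      · obtain ⟨u, hu, hug⟩ := houtR g hgW
        refine mem_union_right _ (mem_filter.2 ⟨hgW, u, hmemQ u hu ?_ fun huP => ?_, hug⟩)
        · rintro rfl
          exact h.proper u g hug (hct.trans hcg.symm)
        · exact hd ⟨g, mem_union_right _ (mem_filter.2 ⟨hgW, u, huP, hug⟩), hgd⟩
      · exact mem_union_left _ (hmemQ g (mem_sdiff.2 ⟨hgR, hgW⟩) hg.2.2 fun hgP =>
          hd ⟨g, mem_union_left _ hgP, hgd⟩)
    · suffices ∃ g, G.Adj g a ∧ G.Adj g d ∧ g ≠ v ∧ g ≠ x ∧ g ∉ W by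
        obtain ⟨g, hga, hgd, hgv, hgx, hgW⟩ := this
        have hcg : c g = c v := h.color_eq_of_common hga (mem_nb.1 ha)
        have hgR : g ∈ R := (hmemR g).2 ⟨hgv, hgx, h.notMem_nb_of_color_eq hcg⟩
        exact ⟨g, mem_union_left _ (hmemQ g (mem_sdiff.2 ⟨hgR, hgW⟩)
          (fun hgt => hct (hgt ▸ hcg)) fun hgP => hd ⟨g, mem_union_left _ hgP, hgd⟩), hga, hgd⟩
      rcases hchoice with hx4 | hnone
      -- A member of `Z` meets N(v) in {a, d, l} with two choices for l. Two members with the same l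
      -- would form, with `v`, three twins; hence |Z| ≤ 2. One of the at least four common
      -- neighbours of `a` and `d` then avoids `v` and `Z`, and so also `x`, which has degree four
      -- here.
      · set Z := univ.filter fun w => w ≠ v ∧ (nb G w).card = 4 ∧ (nb G w ∩ nb G v).card = 3 ∧
          G.Adj w a ∧ G.Adj w d with hZ
        have hZc : Z.card ≤ 2 := by
          by_contra hlt
          have hmap : ∀ w ∈ Z, nb G w ∩ nb G v ∈
              (((nb G v).erase a).erase d).image fun l => ({a, d, l} : Finset V) := by
            intro w hw
            simp only [hZ, mem_filter, mem_univ, true_and] at hw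
            obtain ⟨l, hl, hl'⟩ : ∃ l ∈ nb G w ∩ nb G v, l ∉ ({a, d} : Finset V) :=
              exists_not_mem_of_card_lt (lt_of_le_of_lt card_le_two (by omega))
            simp only [mem_insert, mem_singleton, not_or] at hl'
            refine mem_image.2 ⟨l, ?_, ?_⟩
            · rw [mem_erase, mem_erase]
              exact ⟨hl'.2, hl'.1, (mem_inter.1 hl).2⟩
            · refine eq_of_subset_of_card_le ?_ ?_
              · intro z hz
                simp only [mem_insert, mem_singleton] at hz
                rcases hz with rfl | rfl | rfl
                · exact mem_inter.2 ⟨mem_nb.2 hw.2.2.2.1, ha⟩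
                · exact mem_inter.2 ⟨mem_nb.2 hw.2.2.2.2, hdN⟩
                · exact hl
              · rw [hw.2.2.1, card_eq_three.2 ⟨a, d, l, had, Ne.symm hl'.1, Ne.symm hl'.2, rfl⟩]
          have hc2 : ((((nb G v).erase a).erase d).image
              fun l => ({a, d, l} : Finset V)).card ≤ 2 := by
            refine card_image_le.trans ?_
            rw [card_erase_of_mem (mem_erase.2 ⟨had.symm, hdN⟩), card_erase_of_mem ha, hv]
          obtain ⟨w, hw, w', hw', hww', heq⟩ :=
            exists_ne_map_eq_of_card_lt_of_maps_to (by omega) hmap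
          simp only [hZ, mem_filter, mem_univ, true_and] at hw hw'
          refine h.no_three_twins (v₁ := v) (v₂ := w) (v₃ := w') (T := nb G w ∩ nb G v)
            hw.1.symm hw'.1.symm hww' hw.2.2.1 ?_
          intro z hz
          simp only [mem_insert, mem_singleton] at hz
          rcases hz with rfl | rfl | rfl
          · exact ⟨hv, inter_subset_right⟩
          · exact ⟨hw.2.1, inter_subset_left⟩
          · exact ⟨hw'.2.1, heq.trans_le inter_subset_left⟩
        obtain ⟨g, hga, hgd, hg, -⟩ := h.exists_common hv (X := insert v Z) had ha hdN
          ((card_insert_le _ _).trans (by omega))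
        simp only [mem_insert, not_or] at hg
        have hgZ : ¬ ((nb G g).card = 4 ∧ (nb G g ∩ nb G v).card = 3) := fun hh =>
          hg.2 (by simp [hZ, hg.1, hh.1, hh.2, hga, hgd])
        exact ⟨g, hga, hgd, hg.1, fun hgx => hgZ (hgx ▸ ⟨hx4, hx⟩), fun hgW =>
          hgZ ((hmemW g).1 hgW).2.2⟩
      · obtain ⟨g, hga, hgd, hg, -⟩ := h.exists_common hv (X := {v, x}) had ha hdN
          (card_le_two.trans (by omega))
        simp only [mem_insert, mem_singleton, not_or] at hg
        exact ⟨g, hga, hgd, hg.1, hg.2, fun hgW =>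
          hnone g hg.1 ((hmemW g).1 hgW).2.2.2 ((hmemW g).1 hgW).2.2.1⟩
  have hQfull : ∀ l ∈ nb G v, Touches G (Q ∪ pe Q) l := by
    intro l hl
    by_cases hld : l = d
    · obtain ⟨a, ha, had⟩ : ∃ a ∈ nb G v, a ∉ ({d} : Finset V) :=
        exists_not_mem_of_card_lt (by rw [hv]; simp)
      obtain ⟨g, hg, -, hgd⟩ := hpair a ha (by simpa using had)
      exact ⟨g, hg, hld ▸ hgd⟩
    · obtain ⟨g, hg, hgl, -⟩ := hpair l hl hld
      exact ⟨g, hg, hgl⟩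
  have hQne : Q.Nonempty := by
    obtain ⟨g, hg, -⟩ := hQfull d hdN
    rcases mem_union.1 hg with hg | hg
    · exact ⟨g, hg⟩
    · obtain ⟨-, u, hu, -⟩ := mem_filter.1 hg
      exact ⟨u, hu⟩
  have hpeleaf : ∀ P, ∀ w ∈ pe P, ∃ u ∈ P, G.Adj u w := fun P w hw => (mem_filter.1 hw).2
  have hP'R : insert t P ⊆ R₀ := insert_subset htR₀ hPR
  have hPQ : Disjoint (insert t P) Q := by
    rw [disjoint_left]
    intro z hz hz'
    rw [hQ, mem_erase, mem_sdiff] at hz'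
    exact (mem_insert.1 hz).elim hz'.1 hz'.2.2
  have hR₀W : Disjoint R₀ W := sdiff_disjoint
  refine hrows (insert t P ∪ pe (insert t P)) (Q ∪ pe Q)
    (union_subset (hP'R.trans hR₀R) ((hpeW _).trans hWR))
    (union_subset (hQR₀.trans hR₀R) ((hpeW _).trans hWR)) ?_
    (hconn.union_leaves (hpeleaf _)) (Conn.union_leaves ⟨hQne, hpre⟩ (hpeleaf _)) hPt
    (by rw [filter_true_of_mem hQfull, hv])
  rw [disjoint_union_left, disjoint_union_right, disjoint_union_right]
  refine ⟨⟨hPQ, ?_⟩, ?_, ?_⟩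
  · exact disjoint_of_subset_left hP'R (disjoint_of_subset_right (hpeW _) hR₀W)
  · exact (disjoint_of_subset_left hQR₀ (disjoint_of_subset_right (hpeW _) hR₀W)).symm
  · rw [disjoint_left]
    intro w hw hw'
    obtain ⟨u, hu, huw⟩ := hpeleaf _ w hw
    obtain ⟨u', hu', huw'⟩ := hpeleaf _ w hw'
    have := huniq w (hpeW _ hw) u u' (hR₀R (hP'R hu)) (hR₀R (hQR₀ hu')) huw.symm huw'.symm
    exact disjoint_left.1 hPQ hu (this ▸ hu')

/-- No vertex shares three neighbours with a vertex of degree four. -/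
theorem card_inter_le_two (h : MinimalCounterexample G c) {v x : V} (hv : (nb G v).card = 4)
    (hxv : x ≠ v) : (nb G x ∩ nb G v).card ≤ 2 := by
  have hle : ∀ y, y ≠ v → (nb G y ∩ nb G v).card ≤ 3 := fun y hy => by
    by_contra hlt
    exact h.no_full hv hy (by omega)
  by_contra hlt
  have hx3 : (nb G x ∩ nb G v).card = 3 := by
    have := hle x hxv
    omega
  by_cases hex : ∃ w, w ≠ v ∧ (nb G w ∩ nb G v).card = 3 ∧ (nb G w).card = 4
  · obtain ⟨w, hwv, hw3, hw4⟩ := hex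
    exact h.no_three_of_choice hv hwv hw3 (Or.inl hw4)
  · push Not at hex
    exact h.no_three_of_choice hv hxv hx3 (Or.inr hex)

end MinimalCounterexample

end DegreeFour

end BipartiteMinors

namespace BipartiteMinors

open Finset
open scoped Classical

/-! ### Excluding vertices of degree five -/

section DegreeFive

variable {V : Type*}

/-- Hall's theorem with every label used at most twice: pairs can be assigned to labels
containing them so that the pairs assigned to one label share a vertex. -/
theorem exists_centers (l : V → Finset V) (X : Finset V) (𝒮 : Finset (Finset V))
    (hl : ∀ x ∈ X, (l x).card ≤ 3) (hS₀ : ∀ p ∈ 𝒮, p.card = 2)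
    (hall : ∀ Q ⊆ 𝒮, Q.card ≤ 2 * (X.filter fun x => ∃ p ∈ Q, p ⊆ l x).card) :
    ∃ κ : V → V, ∀ p ∈ 𝒮, ∃ x ∈ X, p ⊆ l x ∧ κ x ∈ p := by
  -- The factor `Bool` provides two copies of each `x`, so an injective choice uses `x` for at most
  -- two pairs. Two pairs inside a set of at most three elements intersect, and a common element
  -- serves as `κ x`.
  let t : 𝒮 → Finset (V × Bool) := fun p => (X.filter fun x => (p : Finset V) ⊆ l x) ×ˢ univ
  obtain ⟨f, hf, hft⟩ := (all_card_le_biUnion_card_iff_exists_injective t).1 (by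
    intro s
    have h1 := hall (s.map (Function.Embedding.subtype _)) (by
      intro p hp
      obtain ⟨q, -, rfl⟩ := mem_map.1 hp
      exact q.2)
    have h2 : s.biUnion t = (X.filter fun x =>
        ∃ p ∈ s.map (Function.Embedding.subtype _), p ⊆ l x) ×ˢ univ := by
      ext ⟨x, b⟩
      simp only [t, mem_biUnion, mem_product, mem_filter, mem_univ, and_true, mem_map,
        Function.Embedding.subtype_apply]
      constructor
      · rintro ⟨p, hp, hx, hpx⟩
        exact ⟨hx, p, ⟨p, hp, rfl⟩, hpx⟩
      · rintro ⟨hx, -, ⟨p, hp, rfl⟩, hpx⟩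
        exact ⟨p, hp, hx, hpx⟩
    rw [h2, card_product, card_univ, Fintype.card_bool, mul_comm]
    simpa using h1)
  have hft' : ∀ p : 𝒮, (f p).1 ∈ X ∧ (p : Finset V) ⊆ l (f p).1 := fun p => by
    simpa [t] using hft p
  have key : ∀ x, ∃ k, ∀ p : 𝒮, (f p).1 = x → k ∈ (p : Finset V) := by
    intro x
    by_cases h1 : ∃ p : 𝒮, (f p).1 = x
    · obtain ⟨p, hp⟩ := h1
      by_cases h2 : ∃ q : 𝒮, (f q).1 = x ∧ q ≠ p
      · obtain ⟨q, hq, hqp⟩ := h2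
        have hcap : ((p : Finset V) ∩ q).Nonempty := by
          rw [← card_pos]
          have h3 := card_union_add_card_inter (p : Finset V) q
          have h4 : ((p : Finset V) ∪ q).card ≤ 3 :=
            (card_le_card (union_subset (hp ▸ (hft' p).2) (hq ▸ (hft' q).2))).trans
              (hl x (hp ▸ (hft' p).1))
          rw [hS₀ p p.2, hS₀ q q.2] at h3
          omega
        obtain ⟨k, hk⟩ := hcap
        refine ⟨k, fun r hr => ?_⟩
        have : r = p ∨ r = q := by
          by_contra hno
          push Not at hno
          have e1 : (f r).2 ≠ (f p).2 := fun h => hno.1 (hf (Prod.ext (hr.trans hp.symm) h))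
          have e2 : (f r).2 ≠ (f q).2 := fun h => hno.2 (hf (Prod.ext (hr.trans hq.symm) h))
          have e3 : (f q).2 ≠ (f p).2 := fun h => hqp (hf (Prod.ext (hq.trans hp.symm) h))
          revert e1 e2 e3
          cases (f r).2 <;> cases (f p).2 <;> cases (f q).2 <;> simp
        rcases this with rfl | rfl
        exacts [(mem_inter.1 hk).1, (mem_inter.1 hk).2]
      · push Not at h2
        obtain ⟨k, hk⟩ : (p : Finset V).Nonempty := card_pos.1 (by rw [hS₀ p p.2]; omega)
        exact ⟨k, fun q hq => h2 q hq ▸ hk⟩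
    · exact ⟨x, fun p hp => absurd ⟨p, hp⟩ h1⟩
  choose κ hκ using key
  exact ⟨κ, fun p hp => ⟨_, (hft' ⟨p, hp⟩).1, (hft' ⟨p, hp⟩).2, hκ _ ⟨p, hp⟩ rfl⟩⟩

/-- A set with at most two elements in `S` contains at most one pair inside `S`. -/
theorem card_pairs_le_one {s S : Finset V} {𝒮 : Finset (Finset V)} (hs : (s ∩ S).card ≤ 2)
    (hS₀ : ∀ p ∈ 𝒮, p.card = 2 ∧ p ⊆ S) : (𝒮.filter fun p => p ⊆ s).card ≤ 1 := by
  have key : ∀ p ∈ 𝒮.filter fun p => p ⊆ s, p = s ∩ S := fun p hp => by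
    rw [mem_filter] at hp
    exact eq_of_subset_of_card_le (subset_inter hp.2 (hS₀ p hp.1).2)
      (by rw [(hS₀ p hp.1).1]; exact hs)
  exact card_le_one.2 fun p hp q hq => (key p hp).trans (key q hq).symm

variable [Fintype V]

namespace MinimalCounterexample

variable {G : SimpleGraph V} {c : V → Bool}

/-- A `K₆` model around a vertex of degree five. -/
theorem no_centers (h : MinimalCounterexample G c) {v : V} (hv : (nb G v).card = 5) (κ : V → V)
    (hκ : ∀ p ∈ nb G v, ∀ q ∈ nb G v, p ≠ q →
      ∃ x, x ≠ v ∧ G.Adj x p ∧ G.Adj x q ∧ (κ x = p ∨ κ x = q)) : False := by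
  -- The six branch sets are `v` and, for each neighbour `p`, the star at `p` whose leaves are the
  -- vertices assigned to `p` by `κ`. A vertex adjacent to `p` and `q` and assigned to one of them
  -- joins the two stars.
  let φ : Option (nb G v) → Finset V := fun o =>
    o.elim {v} fun p => insert (p : V) (univ.filter fun x => x ≠ v ∧ κ x = p ∧ G.Adj x p)
  have hvp : ∀ p : nb G v, G.Adj v p := fun p => mem_nb.1 p.2
  have hcx : ∀ (p : nb G v) (x : V), G.Adj x p → c x = c v := fun p x hx =>
    h.color_eq_of_common hx (hvp p)
  have hsep : ∀ (p q : nb G v) (x : V), G.Adj x p → x ≠ q := fun p q x hx hxq =>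
    h.proper v q (hvp q) (hxq ▸ (hcx p x hx).symm)
  refine h.no_K6 (model_K6 (W := Option (nb G v))
    (by rw [Fintype.card_option, Fintype.card_coe, hv]) φ ?_ ?_ ?_)
  · rintro (_ | p)
    · exact conn_singleton v
    · exact conn_insert_star fun w hw => (mem_filter.1 hw).2.2.2.symm
  · have hvφ : ∀ p, v ∉ φ (some p) := fun p hp => by
      rcases mem_insert.1 hp with hp | hp
      · exact (hvp p).ne hp
      · exact (mem_filter.1 hp).2.1 rfl
    rintro (_ | p) (_ | q) hpq
    · exact absurd rfl hpq
    · exact disjoint_singleton_left.2 (hvφ q)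
    · exact disjoint_singleton_right.2 (hvφ p)
    · have hpq' : (p : V) ≠ q := fun hh => hpq (congrArg some (Subtype.ext hh))
      refine disjoint_left.2 fun x hx hx' => ?_
      rcases mem_insert.1 hx with hx | hx <;> rcases mem_insert.1 hx' with hx' | hx'
      · exact hpq' (hx.symm.trans hx')
      · exact hsep q p x (mem_filter.1 hx').2.2.2 hx
      · exact hsep p q x (mem_filter.1 hx).2.2.2 hx'
      · exact hpq' ((mem_filter.1 hx).2.2.1.symm.trans (mem_filter.1 hx').2.2.1)
  · rintro (_ | p) (_ | q) hpq
    · exact absurd rfl hpq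
    · exact ⟨v, mem_singleton_self v, q, mem_insert_self _ _, hvp q⟩
    · exact ⟨p, mem_insert_self _ _, v, mem_singleton_self v, (hvp p).symm⟩
    · obtain ⟨x, hxv, hxp, hxq, hx | hx⟩ := hκ p p.2 q q.2
        fun hh => hpq (congrArg some (Subtype.ext hh))
      · exact ⟨x, mem_insert_of_mem (by simp [hxv, hx, hxp]), q, mem_insert_self _ _, hxq⟩
      · exact ⟨p, mem_insert_self _ _, x, mem_insert_of_mem (by simp [hxv, hx, hxq]), hxp.symm⟩

/-- Besides `v`, `y`, `z` only one connected row seeing all of `L` is needed. A component of the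
rest sees four of the five neighbours of `v`; if it misses `a ∈ L`, it sees the neighbour `e`
outside `L`. The component of a further neighbour of `a` either sees all of `L` or also sees `e`,
and then `e` joins the two components into the required row. -/
theorem no_four_and_three (h : MinimalCounterexample G c) {v y z : V} {L : Finset V}
    (hv : (nb G v).card = 5) (hL : L.card = 4) (hLv : L ⊆ nb G v) (hyv : y ≠ v) (hzv : z ≠ v)
    (hyz : y ≠ z) (hy : L ⊆ nb G y) (hz : 3 ≤ (nb G z ∩ L).card) : False := by
  have hcol : ∀ x l, l ∈ L → G.Adj x l → c x = c v := fun x l hl hx =>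
    h.color_eq_of_common hx (mem_nb.1 (hLv hl))
  have hcy : c y = c v := by
    obtain ⟨l, hl⟩ : L.Nonempty := card_pos.1 (by omega)
    exact hcol y l hl (mem_nb.1 (hy hl))
  have hcz : c z = c v := by
    obtain ⟨l, hl⟩ : (nb G z ∩ L).Nonempty := card_pos.1 (by omega)
    rw [mem_inter, mem_nb] at hl
    exact hcol z l hl.2 hl.1
  have hnL : ∀ x, c x = c v → x ∉ L := fun x hx hxL => h.notMem_nb_of_color_eq hx (hLv hxL)
  set s := univ \ (insert v {y, z} ∪ nb G v) with hs
  have hmem : ∀ x, x ∈ s ↔ x ∉ ({v, y, z} : Finset V) ∧ x ∉ nb G v := fun x => by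
    rw [hs, mem_sdiff, mem_union, not_or]
    simp
  have hrows : ∀ K, Conn G K → (∀ x ∈ K, x ∉ ({v, y, z} : Finset V) ∧ x ∉ L) →
      (∀ l ∈ L, Touches G K l) → False := by
    intro K hK hKd hKL
    refine h.no_rows (X₁ := K) (X₂ := {y}) (X₃ := {z}) hL (fun l hl => mem_nb.1 (hLv hl)) hK
      (conn_singleton y) (conn_singleton z) (fun hvK => (hKd v hvK).1 (by simp))
      (by simpa using hyv.symm) (by simpa using hzv.symm)
      (by simpa using fun hyK => (hKd y hyK).1 (by simp))
      (by simpa using fun hzK => (hKd z hzK).1 (by simp)) (by simpa using hyz)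
      (disjoint_left.2 fun x hx => (hKd x hx).2) (by simpa using hnL y hcy)
      (by simpa using hnL z hcz) (by rw [filter_true_of_mem hKL, hL]) ?_ ?_
    · rw [filter_true_of_mem, hL]
      exact fun l hl => touches_singleton.2 (mem_nb.1 (hy hl))
    · refine hz.trans (card_le_card fun l hl => ?_)
      rw [mem_inter, mem_nb] at hl
      exact mem_filter.2 ⟨hl.2, touches_singleton.2 hl.1⟩
  have hcomp : ∀ x ∈ s, ∃ K, x ∈ K ∧ Conn G K ∧ K ⊆ s ∧
      4 ≤ ((nb G v).filter (Touches G K)).card := by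
    intro x hx
    obtain ⟨K, hKs, hxK, hK, hcl⟩ := exists_component (G := G) s hx
    exact ⟨K, hxK, hK, hKs, h.four_le_touches card_le_two (by simp [hcy, hcz])
      (by simp [hyv.symm, hzv.symm]) hK hKs hcl⟩
  -- a component missing a vertex of `L` sees all other neighbours of `v`
  have hother : ∀ K : Finset V, 4 ≤ ((nb G v).filter (Touches G K)).card →
      ∀ a ∈ nb G v, ¬ Touches G K a → ∀ l ∈ nb G v, l ≠ a → Touches G K l := by
    intro K hK a ha haK l hl hla
    by_contra hlK
    have hsub : (nb G v).filter (Touches G K) ⊆ ((nb G v).erase a).erase l := by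
      intro x hx
      rw [mem_filter] at hx
      rw [mem_erase, mem_erase]
      exact ⟨fun hxl => hlK (hxl ▸ hx.2), fun hxa => haK (hxa ▸ hx.2), hx.1⟩
    have := card_le_card hsub
    rw [card_erase_of_mem (mem_erase.2 ⟨hla, hl⟩), card_erase_of_mem ha, hv] at this
    omega
  have hKd : ∀ K ⊆ s, ∀ x ∈ K, x ∉ ({v, y, z} : Finset V) ∧ x ∉ L := fun K hK x hx =>
    ⟨((hmem x).1 (hK hx)).1, fun hxL => ((hmem x).1 (hK hx)).2 (hLv hxL)⟩
  obtain ⟨x, hx, hx'⟩ : ∃ x ∈ univ.filter (fun x => c x = c v), x ∉ ({v, y, z} : Finset V) :=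
    exists_not_mem_of_card_lt (lt_of_le_of_lt card_le_three (by have := h.parts (c v); omega))
  obtain ⟨K, -, hK, hKs, hK4⟩ := hcomp x
    ((hmem x).2 ⟨hx', h.notMem_nb_of_color_eq (mem_filter.1 hx).2⟩)
  by_cases hKL : ∀ l ∈ L, Touches G K l
  · exact hrows K hK (hKd K hKs) hKL
  push Not at hKL
  obtain ⟨a, haL, haK⟩ := hKL
  obtain ⟨w, hw, hw'⟩ : ∃ w ∈ nb G a, w ∉ ({v, y, z} : Finset V) :=
    exists_not_mem_of_card_lt (lt_of_le_of_lt card_le_three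
      (by have := h.four_le_degree a; omega))
  rw [mem_nb] at hw
  obtain ⟨K', hwK', hK', hKs', hK4'⟩ := hcomp w
    ((hmem w).2 ⟨hw', h.notMem_nb_of_color_eq (hcol w a haL hw.symm)⟩)
  by_cases hKL' : ∀ l ∈ L, Touches G K' l
  · exact hrows K' hK' (hKd K' hKs') hKL'
  push Not at hKL'
  obtain ⟨a', haL', haK'⟩ := hKL'
  obtain ⟨e, heN, heL⟩ : ∃ e ∈ nb G v, e ∉ L := exists_not_mem_of_card_lt (by omega)
  have heK := hother K hK4 a (hLv haL) haK e heN fun hea => heL (hea ▸ haL)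
  obtain ⟨u, hu, hue⟩ := hother K' hK4' a' (hLv haL') haK' e heN fun hea => heL (hea ▸ haL')
  refine hrows (insert e K ∪ K')
    ((hK.insert heK).union hK' ⟨e, mem_insert_self _ _, u, hu, hue.symm⟩) ?_ ?_
  · intro x hx
    rcases mem_union.1 hx with hx | hx
    · rcases mem_insert.1 hx with rfl | hx
      · refine ⟨fun hxV => ?_, heL⟩
        have hcx : c x = c v := by
          simp only [mem_insert, mem_singleton] at hxV
          rcases hxV with rfl | rfl | rfl
          exacts [rfl, hcy, hcz]
        exact h.notMem_nb_of_color_eq hcx heN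
      · exact hKd K hKs x hx
    · exact hKd K' hKs' x hx
  · intro l hl
    by_cases hla : l = a
    · exact ⟨w, mem_union_right _ hwK', hla ▸ hw.symm⟩
    · exact (hother K hK4 a (hLv haL) haK l (hLv hl) hla).mono
        ((subset_insert _ _).trans subset_union_left)

/-- No vertex has degree five. -/
theorem degree_ne_five (h : MinimalCounterexample G c) (v : V) : (nb G v).card ≠ 5 := by
  intro hv
  set l : V → Finset V := fun x => nb G x ∩ nb G v with hl
  have hlx : ∀ {p : Finset V} {x : V}, p ⊆ l x → ∀ a ∈ p, G.Adj x a := fun hp a ha =>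
    mem_nb.1 (mem_inter.1 (hp ha)).1
  -- every pair of neighbours is covered by two labels
  have hcov : ∀ p ∈ (nb G v).powersetCard 2, ∀ Y : Finset V, v ∈ Y →
      3 ≤ ((univ \ Y).filter fun x => p ⊆ l x).card + (Y.filter fun x => p ⊆ l x).card := by
    intro p hp Y hvY
    obtain ⟨hpN, hp2⟩ := mem_powersetCard.1 hp
    obtain ⟨a, b, hab, rfl⟩ := card_eq_two.1 hp2
    have ha : a ∈ nb G v := hpN (by simp)
    have hb : b ∈ nb G v := hpN (by simp)
    have h8 := h.eight_le hab (mem_nb.1 ha) (mem_nb.1 hb)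
    have hsub : nb G a ∩ nb G b ⊆ ((univ \ Y).filter fun x => {a, b} ⊆ l x) ∪
        (Y.filter fun x => {a, b} ⊆ l x) := by
      intro x hx
      rw [mem_inter, mem_nb, mem_nb] at hx
      have hxl : {a, b} ⊆ l x := by
        simp only [insert_subset_iff, singleton_subset_iff, hl, mem_inter, mem_nb]
        exact ⟨⟨hx.1.symm, mem_nb.1 ha⟩, hx.2.symm, mem_nb.1 hb⟩
      by_cases hxY : x ∈ Y
      · exact mem_union_right _ (mem_filter.2 ⟨hxY, hxl⟩)
      · exact mem_union_left _ (mem_filter.2 ⟨by simpa using hxY, hxl⟩)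
    have := (card_le_card hsub).trans (card_union_le _ _)
    omega
  have hcenter : ∀ κ : V → V, (∀ p ∈ (nb G v).powersetCard 2,
      ∃ x, x ≠ v ∧ p ⊆ l x ∧ κ x ∈ p) → False := by
    intro κ hκ
    refine h.no_centers hv κ fun p hp q hq hpq => ?_
    obtain ⟨x, hxv, hx, hxκ⟩ := hκ {p, q} (mem_powersetCard.2
      ⟨by simp [insert_subset_iff, mem_nb.1 hp, mem_nb.1 hq], card_pair hpq⟩)
    exact ⟨x, hxv, hlx hx p (by simp), hlx hx q (by simp), by simpa using hxκ⟩
  -- double counting in Hall's condition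
  have hcount : ∀ (X : Finset V) (Q Q' : Finset (Finset V)) (m n : ℕ), Q' ⊆ Q →
      (∀ p ∈ Q', m ≤ (X.filter fun x => p ⊆ l x).card) →
      (∀ x ∈ X, (Q'.filter fun p => p ⊆ l x).card ≤ n) →
      Q'.card * m ≤ (X.filter fun x => ∃ p ∈ Q, p ⊆ l x).card * n := by
    intro X Q Q' m n hQ' hm hn
    refine card_mul_le_card_mul (fun p x => p ⊆ l x) (fun p hp => ?_)
      fun x hx => hn x (mem_filter.1 hx).1
    refine (hm p hp).trans (card_le_card fun x hx => ?_)
    rw [mem_filter] at hx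
    exact mem_filter.2 ⟨mem_filter.2 ⟨hx.1, p, hQ' hp, hx.2⟩, hx.2⟩
  by_cases hbig : ∃ y, y ≠ v ∧ 4 ≤ (l y).card
  · obtain ⟨y, hyv, hy⟩ := hbig
    have hvy : ({v, y} : Finset V).card = 2 := card_pair hyv.symm
    have hXne : ∀ x ∈ univ \ ({v, y} : Finset V), x ≠ v ∧ x ≠ y := fun x hx => by
      simpa using hx
    obtain ⟨L, hLy, hL⟩ := exists_subset_card_eq hy
    have hLv : L ⊆ nb G v := hLy.trans inter_subset_right
    have hthree : ∀ M ⊆ l y, M.card = 4 → ∀ x ∈ univ \ ({v, y} : Finset V),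
        (l x ∩ M).card ≤ 2 := by
      intro M hM hM4 x hx
      by_contra hlt
      refine h.no_four_and_three hv hM4 (hM.trans inter_subset_right) hyv (hXne x hx).1
        (hXne x hx).2.symm (hM.trans inter_subset_left) ((by omega : 3 ≤ (l x ∩ M).card).trans
          (card_le_card ?_))
      exact inter_subset_inter_right inter_subset_left
    obtain ⟨e, heN, heL⟩ : ∃ e ∈ nb G v, e ∉ L := exists_not_mem_of_card_lt (by omega)
    have hNL : nb G v = insert e L := by
      refine (eq_of_subset_of_card_le (insert_subset heN hLv) ?_).symm
      rw [card_insert_of_notMem heL, hL, hv]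
    by_cases hey : e ∈ l y
    · -- all neighbours of `v` are neighbours of `y`
      have hNy : nb G v ⊆ l y := by
        rw [hNL]
        exact insert_subset hey hLy
      have hl2 : ∀ x ∈ univ \ ({v, y} : Finset V), (l x).card ≤ 2 := by
        intro x hx
        by_contra hlt
        obtain ⟨T, hT, hT3⟩ := exists_subset_card_eq (by omega : 3 ≤ (l x).card)
        obtain ⟨M, hTM, hMN, hM⟩ := exists_subsuperset_card_eq
          (hT.trans inter_subset_right : T ⊆ nb G v) (by omega : T.card ≤ 4) (by omega)
        have := hthree M (hMN.trans hNy) hM x hx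
        have := card_le_card (subset_inter hT hTM)
        omega
      -- Each pair lies in at least one label other than those of `v` and `y`, and a label of size
      -- at most two holds at most one pair.
      obtain ⟨κ, hκ⟩ := exists_centers l (univ \ {v, y}) ((nb G v).powersetCard 2)
        (fun x hx => (hl2 x hx).trans (by omega)) (fun p hp => (mem_powersetCard.1 hp).2) (by
          intro Q hQ
          have := hcount (univ \ {v, y}) Q Q 1 1 Subset.rfl (fun p hp => by
              have h3 := hcov p (hQ hp) {v, y} (by simp)
              have h4 := card_filter_le ({v, y} : Finset V) fun x => p ⊆ l x
              omega)
            (fun x hx => card_pairs_le_one (S := nb G v)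
              ((card_le_card inter_subset_left).trans (hl2 x hx))
              fun p hp => (mem_powersetCard.1 (hQ hp)).symm)
          omega)
      exact hcenter κ fun p hp => by
        obtain ⟨x, hx, h1, h2⟩ := hκ p hp
        exact ⟨x, (hXne x hx).1, h1, h2⟩
    · obtain ⟨a, ha⟩ : L.Nonempty := card_pos.1 (by omega)
      have hl3 : ∀ x ∈ univ \ ({v, y} : Finset V), (l x).card ≤ 3 := by
        intro x hx
        have h1 := hthree L hLy hL x hx
        have h2 : l x ⊆ insert e (l x ∩ L) := fun z hz => by
          have hz' : z ∈ nb G v := (mem_inter.1 hz).2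
          rw [hNL, mem_insert] at hz'
          rcases hz' with rfl | hz'
          · exact mem_insert_self _ _
          · exact mem_insert_of_mem (mem_inter.2 ⟨hz, hz'⟩)
        have := (card_le_card h2).trans (card_insert_le _ _)
        omega
      -- `y` will have centre `a` and serve the pairs of `L` through `a`. In Hall's condition for
      -- the other pairs, those inside `L` have at least one available label and a label holds at
      -- most one of them. Those through `e` are not in the label of `y`, so they have at least two,
      -- and a label holds at most two. Hence each of the two kinds is at most as numerous as the
      -- labels, which gives the factor two.
      obtain ⟨κ, hκ⟩ := exists_centers l (univ \ {v, y})
        (((nb G v).powersetCard 2).filter fun p => ¬ (a ∈ p ∧ p ⊆ L))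
        hl3 (fun p hp => (mem_powersetCard.1 (mem_filter.1 hp).1).2) (by
          intro Q hQ
          have hQ' : ∀ p ∈ Q, p ∈ (nb G v).powersetCard 2 := fun p hp => (mem_filter.1 (hQ hp)).1
          have h1 := hcount (univ \ {v, y}) Q (Q.filter fun p => p ⊆ L) 1 1
            (filter_subset _ _) (fun p hp => by
              have h3 := hcov p (hQ' p (mem_filter.1 hp).1) {v, y} (by simp)
              have h4 := card_filter_le ({v, y} : Finset V) fun x => p ⊆ l x
              omega)
            (fun x hx => card_pairs_le_one (hthree L hLy hL x hx) fun p hp =>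
              ⟨(mem_powersetCard.1 (hQ' p (mem_filter.1 hp).1)).2, (mem_filter.1 hp).2⟩)
          have heP : ∀ p ∈ Q.filter fun p => ¬ p ⊆ L, e ∈ p := fun p hp => by
            obtain ⟨hp, hpL⟩ := mem_filter.1 hp
            obtain ⟨z, hz, hzL⟩ := not_subset.1 hpL
            have hz' := (mem_powersetCard.1 (hQ' p hp)).1 hz
            rw [hNL, mem_insert] at hz'
            exact hz'.resolve_right hzL ▸ hz
          have h2 := hcount (univ \ {v, y}) Q (Q.filter fun p => ¬ p ⊆ L) 2 2
            (filter_subset _ _) (fun p hp => by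
              have h3 := hcov p (hQ' p (mem_filter.1 hp).1) {v, y} (by simp)
              have h4 : (({v, y} : Finset V).filter fun x => p ⊆ l x) ⊆ {v} := fun x hx => by
                rw [mem_filter, mem_insert, mem_singleton] at hx
                rw [mem_singleton]
                refine hx.1.resolve_right fun hxy => hey ?_
                exact hxy ▸ hx.2 (heP p hp)
              have := card_le_card h4
              rw [card_singleton] at this
              omega)
            (fun x hx => by
              have h3 := hthree L hLy hL x hx
              have h4 : ((Q.filter fun p => ¬ p ⊆ L).filter fun p => p ⊆ l x) ⊆
                  (l x ∩ L).image fun z => ({e, z} : Finset V) := by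
                intro p hp
                obtain ⟨hp, hpx⟩ := mem_filter.1 hp
                obtain ⟨hpN, hp2⟩ := mem_powersetCard.1 (hQ' p (mem_filter.1 hp).1)
                have hep := heP p hp
                obtain ⟨z, hz, hze⟩ : ∃ z ∈ p, z ∉ ({e} : Finset V) :=
                  exists_not_mem_of_card_lt (by rw [hp2]; simp)
                rw [mem_singleton] at hze
                have hzN := hpN hz
                rw [hNL, mem_insert] at hzN
                refine mem_image.2 ⟨z, mem_inter.2 ⟨hpx hz, hzN.resolve_left hze⟩, ?_⟩
                exact eq_of_subset_of_card_le (by simp [insert_subset_iff, hep, hz])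
                  (by rw [hp2, card_pair (Ne.symm hze)])
              exact (card_le_card h4).trans (card_image_le.trans h3))
          have h5 := card_filter_add_card_filter_not (s := Q) (fun p => p ⊆ L)
          omega)
      refine hcenter (fun x => if x = y then a else κ x) fun p hp => ?_
      by_cases hpa : a ∈ p ∧ p ⊆ L
      · exact ⟨y, hyv, hpa.2.trans hLy, by simpa using hpa.1⟩
      · obtain ⟨x, hx, h1, h2⟩ := hκ p (mem_filter.2 ⟨hp, hpa⟩)
        exact ⟨x, (hXne x hx).1, h1, by simpa [(hXne x hx).2] using h2⟩
  · push Not at hbig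
    have hX : ∀ x ∈ univ \ ({v} : Finset V), (l x).card ≤ 3 := fun x hx => by
      have := hbig x (by simpa using hx)
      omega
    -- Every pair lies in at least two labels apart from that of `v`, and a label of size at most
    -- three holds at most three pairs. So 2|Q| is at most three times the number of labels meeting
    -- the condition.
    obtain ⟨κ, hκ⟩ := exists_centers l (univ \ {v}) ((nb G v).powersetCard 2) hX
      (fun p hp => (mem_powersetCard.1 hp).2) (by
        intro Q hQ
        have := hcount (univ \ {v}) Q Q 2 3 Subset.rfl (fun p hp => by
            have h3 := hcov p (hQ hp) {v} (by simp)
            have h4 := card_filter_le ({v} : Finset V) fun x => p ⊆ l x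
            rw [card_singleton] at h4
            omega)
          (fun x hx => by
            have hsub : (Q.filter fun p => p ⊆ l x) ⊆ (l x).powersetCard 2 := fun p hp => by
              obtain ⟨hp, hpx⟩ := mem_filter.1 hp
              exact mem_powersetCard.2 ⟨hpx, (mem_powersetCard.1 (hQ hp)).2⟩
            refine (card_le_card hsub).trans ?_
            rw [card_powersetCard]
            exact (Nat.choose_le_choose 2 (hX x hx)).trans (by decide))
        omega)
    exact hcenter κ fun p hp => by
      obtain ⟨x, hx, h1, h2⟩ := hκ p hp
      exact ⟨x, by simpa using hx, h1, h2⟩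

end MinimalCounterexample

end DegreeFive

end BipartiteMinors

namespace BipartiteMinors

open Finset
open scoped Classical

/-! ### Sparsity of degree-four vertices and discharging -/

section Discharging

variable {V : Type*} [Fintype V]

namespace MinimalCounterexample

variable {G : SimpleGraph V} {c : V → Bool}

/-- The neighbours of degree four. -/
noncomputable def smallNb (G : SimpleGraph V) (a : V) : Finset V :=
  (nb G a).filter fun w => (nb G w).card = 4

/-- Each of the three other neighbours `b` of `v` shares with `a` at least three vertices besides
`v`. By `card_inter_le_two` these are distinct for different `b`, so `a` has at least 1 + 3·3
neighbours. -/
theorem ten_le_degree (h : MinimalCounterexample G c) {a v : V} (hv : (nb G v).card = 4)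
    (hva : G.Adj v a) : 10 ≤ (nb G a).card := by
  have haN : a ∈ nb G v := mem_nb.2 hva
  have hdisj : ∀ b ∈ (nb G v).erase a, ∀ b' ∈ (nb G v).erase a, b ≠ b' →
      Disjoint ((nb G a ∩ nb G b).erase v) ((nb G a ∩ nb G b').erase v) := by
    intro b hb b' hb' hbb'
    refine disjoint_left.2 fun x hx hx' => ?_
    rw [mem_erase, mem_inter, mem_nb, mem_nb] at hx hx'
    rw [mem_erase] at hb hb'
    have h2 := h.card_inter_le_two hv hx.1
    have h3 : ({a, b, b'} : Finset V) ⊆ nb G x ∩ nb G v := by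
      simp only [insert_subset_iff, singleton_subset_iff, mem_inter, mem_nb]
      exact ⟨⟨hx.2.1.symm, hva⟩, ⟨hx.2.2.symm, mem_nb.1 hb.2⟩, hx'.2.2.symm, mem_nb.1 hb'.2⟩
    have h4 := card_le_card h3
    rw [card_eq_three.2 ⟨a, b, b', hb.1.symm, hb'.1.symm, hbb', rfl⟩] at h4
    omega
  have hsub : insert v (((nb G v).erase a).biUnion fun b => (nb G a ∩ nb G b).erase v) ⊆
      nb G a := by
    refine insert_subset (mem_nb.2 hva.symm) fun x hx => ?_
    obtain ⟨b, -, hx⟩ := mem_biUnion.1 hx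
    exact (mem_inter.1 (mem_erase.1 hx).2).1
  have hcard := card_le_card hsub
  rw [card_insert_of_notMem (by simp), card_biUnion hdisj] at hcard
  have hsum : ((nb G v).erase a).card • 3 ≤
      ∑ b ∈ (nb G v).erase a, ((nb G a ∩ nb G b).erase v).card := by
    refine card_nsmul_le_sum _ _ _ fun b hb => ?_
    rw [mem_erase, mem_nb] at hb
    have h8 := h.eight_le hb.1.symm hva hb.2
    rw [card_erase_of_mem (by simp [hva.symm, hb.2.symm])]
    omega
  rw [card_erase_of_mem haN, hv, smul_eq_mul] at hsum
  omega

/-- A vertex cannot have too many neighbours of degree four. -/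
theorem card_smallNb (h : MinimalCounterexample G c) {a : V} (ha : (smallNb G a).Nonempty) :
    (smallNb G a).card + 12 ≤ 2 * (nb G a).card := by
  -- Write d = deg a and f = |F|. Failure means f ≥ 2d-11, and with f ≤ d and d ≥ 10 at most one
  -- neighbour of `a` lies outside `F`. The sets N(w) without `a`, for `w` in `F`, behave as
  -- three-point lines meeting pairwise in at most one point, and each point is adjacent to at least
  -- four neighbours of `a`. This is too many incidences for so few lines.
  by_contra hlt
  set F := smallNb G a with hF
  have hmemF : ∀ {w}, w ∈ F → G.Adj a w ∧ (nb G w).card = 4 := fun hw => by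
    simpa [hF, smallNb] using hw
  have hFa : F ⊆ nb G a := filter_subset _ _
  have hFc := card_le_card hFa
  obtain ⟨v, hvF⟩ := ha
  have h10 := h.ten_le_degree (hmemF hvF).2 (hmemF hvF).1.symm
  set Z := nb G a \ F with hZ
  have hZc : Z.card + F.card = (nb G a).card := card_sdiff_add_card_eq_card hFa
  -- the points on the lines given by `F`
  let T : V → Finset V := fun w => (nb G w).erase a
  have hTc : ∀ w ∈ F, (T w).card = 3 := fun w hw => by
    rw [card_erase_of_mem (mem_nb.2 (hmemF hw).1.symm), (hmemF hw).2]
  have hmeet : ∀ w ∈ F, ∀ x ∈ nb G a, x ≠ w → (nb G x ∩ T w).card ≤ 1 := by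
    intro w hw x hx hxw
    have h2 := h.card_inter_le_two (hmemF hw).2 hxw
    have h3 : nb G x ∩ T w ⊆ (nb G x ∩ nb G w).erase a := fun z hz => by
      simp only [T, mem_inter, mem_erase] at hz ⊢
      tauto
    have h4 := card_le_card h3
    rw [card_erase_of_mem (mem_inter.2 ⟨mem_nb.2 (mem_nb.1 hx).symm,
      mem_nb.2 (hmemF hw).1.symm⟩)] at h4
    omega
  have hdeg : ∀ w ∈ F, ∀ b ∈ T w, 4 ≤ (F.filter fun w => G.Adj w b).card +
      (Z.filter fun z => G.Adj z b).card := by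
    intro w hw b hb
    simp only [T, mem_erase, mem_nb] at hb
    have h8 := h.eight_le hb.1.symm (hmemF hw).1.symm hb.2
    have hsub : nb G a ∩ nb G b ⊆ (F.filter fun w => G.Adj w b) ∪
        (Z.filter fun z => G.Adj z b) := by
      intro x hx
      obtain ⟨hx1, hx2⟩ := mem_inter.1 hx
      by_cases hxF : x ∈ F
      · exact mem_union_left _ (mem_filter.2 ⟨hxF, (mem_nb.1 hx2).symm⟩)
      · exact mem_union_right _ (mem_filter.2 ⟨mem_sdiff.2 ⟨hx1, hxF⟩, (mem_nb.1 hx2).symm⟩)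
    have h1 := (card_le_card hsub).trans (card_union_le _ _)
    have h2 := (hmemF hw).2
    omega
  have hZ1 : Z.card ≤ 1 := by omega
  have hZT : ∀ w ∈ F, ((T w).filter fun b => ∃ z ∈ Z, G.Adj z b).card ≤ 1 := by
    intro w hw
    rcases Z.eq_empty_or_nonempty with he | ⟨z, hz⟩
    · simp [he]
    · have hzn := mem_sdiff.1 hz
      refine (card_le_card fun b hb => ?_).trans
        (hmeet w hw z hzn.1 fun hzw => hzn.2 (hzw ▸ hw))
      obtain ⟨hbT, z', hz', hzb⟩ := mem_filter.1 hb
      rw [card_le_one.1 hZ1 z' hz' z hz] at hzb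
      exact mem_inter.2 ⟨mem_nb.2 hzb, hbT⟩
  set U := F.biUnion T with hU
  have hTU : ∀ w ∈ F, U.filter (fun b => G.Adj w b) = T w := by
    intro w hw
    ext b
    simp only [hU, mem_filter, mem_biUnion, T, mem_erase, mem_nb]
    constructor
    · rintro ⟨⟨w', hw', hba, -⟩, hwb⟩
      exact ⟨hba, hwb⟩
    · exact fun hb => ⟨⟨w, hw, hb⟩, hb.2⟩
  set Uz := U.filter fun b => ∃ z ∈ Z, G.Adj z b with hUz
  have hZle : ∀ b, (Z.filter fun z => G.Adj z b).card ≤ 1 := fun b =>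
    (card_le_card (filter_subset _ _)).trans hZ1
  have hUdeg : ∀ b ∈ U, 3 ≤ (F.filter fun w => G.Adj w b).card := by
    intro b hb
    obtain ⟨w, hw, hbw⟩ := mem_biUnion.1 hb
    have := hdeg w hw b hbw
    have := hZle b
    omega
  -- few points are adjacent to the remaining neighbour
  have hUz3 : Uz.card * 3 ≤ F.card * 1 := by
    refine card_mul_le_card_mul (fun b w => G.Adj w b)
      (fun b hb => hUdeg b (mem_filter.1 hb).1) fun w hw => ?_
    refine (card_le_card fun b hb => ?_).trans (hZT w hw)
    obtain ⟨hb, hwb⟩ := mem_filter.1 hb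
    obtain ⟨hbU, hbz⟩ := mem_filter.1 hb
    exact mem_filter.2 ⟨hTU w hw ▸ mem_filter.2 ⟨hbU, hwb⟩, hbz⟩
  -- there are at least nine points
  have hU9 : 9 ≤ U.card := by
    -- A point of `T v` not adjacent to the exceptional neighbour lies on at least four lines, each
    -- with two further points and no two sharing one: 1 + 4·2 points.
    obtain ⟨b, hb, hbz⟩ : ∃ b ∈ T v, b ∉ (T v).filter fun b => ∃ z ∈ Z, G.Adj z b :=
      exists_not_mem_of_card_lt (by have := hZT v hvF; have := hTc v hvF; omega)
    have hb0 : (Z.filter fun z => G.Adj z b) = ∅ := by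
      refine filter_eq_empty_iff.2 fun z hz hzb => hbz (mem_filter.2 ⟨hb, z, hz, hzb⟩)
    have h4 := hdeg v hvF b hb
    rw [hb0, card_empty] at h4
    set Fb := F.filter fun w => G.Adj w b with hFb
    have hba : b ≠ a := (mem_erase.1 hb).1
    have hbT : ∀ w ∈ Fb, b ∈ T w := fun w hw =>
      mem_erase.2 ⟨hba, mem_nb.2 (mem_filter.1 hw).2⟩
    have hdisj : ∀ w ∈ Fb, ∀ w' ∈ Fb, w ≠ w' → Disjoint ((T w).erase b) ((T w').erase b) := by
      intro w hw w' hw' hww'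
      refine disjoint_left.2 fun x hx hx' => ?_
      have h1 := hmeet w' (mem_filter.1 hw').1 w (hFa (mem_filter.1 hw).1) hww'
      refine (mem_erase.1 hx).1 (card_le_one.1 h1 x ?_ b ?_)
      · exact mem_inter.2 ⟨(mem_erase.1 (mem_erase.1 hx).2).2, (mem_erase.1 hx').2⟩
      · exact mem_inter.2 ⟨(mem_erase.1 (hbT w hw)).2, hbT w' hw'⟩
    have hsub : insert b (Fb.biUnion fun w => (T w).erase b) ⊆ U := by
      refine insert_subset (mem_biUnion.2 ⟨v, hvF, hb⟩) fun x hx => ?_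
      obtain ⟨w, hw, hx⟩ := mem_biUnion.1 hx
      exact mem_biUnion.2 ⟨w, (mem_filter.1 hw).1, (mem_erase.1 hx).2⟩
    have hcard := card_le_card hsub
    rw [card_insert_of_notMem (by simp), card_biUnion hdisj] at hcard
    have hsum : Fb.card • 2 ≤ ∑ w ∈ Fb, ((T w).erase b).card := by
      refine card_nsmul_le_sum _ _ _ fun w hw => ?_
      rw [card_erase_of_mem (hbT w hw), hTc w (mem_filter.1 hw).1]
    rw [smul_eq_mul] at hsum
    omega
  -- double counting of incidences
  have hdouble : ∑ w ∈ F, (U.filter fun b => G.Adj w b).card =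
      ∑ b ∈ U, (F.filter fun w => G.Adj w b).card :=
    sum_card_bipartiteAbove_eq_sum_card_bipartiteBelow fun w b => G.Adj w b
  have hleft : ∑ w ∈ F, (U.filter fun b => G.Adj w b).card = F.card * 3 := by
    rw [sum_congr rfl fun w hw => by rw [hTU w hw, hTc w hw], sum_const, smul_eq_mul]
  have hright : U.card * 4 ≤ ∑ b ∈ U, (F.filter fun w => G.Adj w b).card + Uz.card := by
    rw [hUz, card_filter, ← sum_add_distrib, ← smul_eq_mul, ← sum_const]
    refine sum_le_sum fun b hb => ?_
    obtain ⟨w, hw, hbw⟩ := mem_biUnion.1 hb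
    have h1 := hdeg w hw b hbw
    have h2 := hZle b
    split_ifs with hz
    · omega
    · have : (Z.filter fun z => G.Adj z b) = ∅ :=
        filter_eq_empty_iff.2 fun z hz' hzb => hz ⟨z, hz', hzb⟩
      rw [this, card_empty] at h1
      omega
  -- The count reads 36 ≤ 4|U| ≤ 3f + |Uz|. If `Z` is empty, then |Uz| = 0 while f ≤ 11. Otherwise d
  -- = 10, f = 9 and |Uz| ≤ 3. Both are impossible.
  have hUz0 : Z.card = 0 → Uz.card = 0 := by
    intro hZ0
    rw [card_eq_zero] at hZ0
    simp [hUz, hZ0]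
  omega

theorem sum_degree (h : MinimalCounterexample G c) :
    ∑ v, (nb G v).card + 18 = 6 * Fintype.card V := by
  have hσ : ∀ σ, (edgesIn G c σ univ).card =
      ∑ v ∈ univ.filter fun v => c v = σ, (nb G v).card := by
    intro σ
    rw [edgesIn, card_filter, sum_product, sum_filter]
    refine sum_congr rfl fun v _ => ?_
    by_cases hv : c v = σ
    · simp [hv, nb]
    · simp [hv]
  have hsum := sum_filter_add_sum_filter_not univ (fun v => c v = true) fun v => (nb G v).card
  have hfalse : (univ.filter fun v => ¬ c v = true) = univ.filter fun v => c v = false := by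
    simp
  rw [hfalse, ← hσ, ← hσ] at hsum
  have h1 := h.edges true
  have h2 := h.edges false
  omega

/-- Discharging, doubled to stay in integers: each vertex sends 1/2 to every neighbour of degree
four, so a vertex of degree four receives 2. All final charges are at least six, using
`card_smallNb` for senders and `degree_ne_five` for the others, but the total is 6n-18. -/
theorem false (h : MinimalCounterexample G c) : False := by
  have hpoint : ∀ v, (smallNb G v).card + 12 ≤
      2 * (nb G v).card + if (nb G v).card = 4 then 4 else 0 := by
    intro v
    rcases (smallNb G v).eq_empty_or_nonempty with he | hne
    · rw [he, card_empty]
      have h4 := h.four_le_degree v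
      have h5 := h.degree_ne_five v
      split_ifs <;> omega
    · have := h.card_smallNb hne
      omega
  have hsum := sum_le_sum fun v (_ : v ∈ (univ : Finset V)) => hpoint v
  rw [sum_add_distrib, sum_add_distrib, sum_const, card_univ, smul_eq_mul, ← mul_sum,
    ← sum_filter, sum_const, smul_eq_mul] at hsum
  have hdouble : ∑ v, (smallNb G v).card =
      (univ.filter fun v => (nb G v).card = 4).card * 4 := by
    have h1 : ∀ v, smallNb G v =
        (univ.filter fun w => (nb G w).card = 4).filter fun w => G.Adj v w := by
      intro v
      ext w
      simp [smallNb, and_comm]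
    have h2 := sum_card_bipartiteAbove_eq_sum_card_bipartiteBelow (s := univ)
      (t := univ.filter fun w => (nb G w).card = 4) fun v w => G.Adj v w
    simp only [h1]
    refine h2.trans ?_
    rw [← smul_eq_mul, ← sum_const]
    refine sum_congr rfl fun w hw => ?_
    rw [← (mem_filter.1 hw).2]
    congr 1
    ext v
    simp [bipartiteBelow, G.adj_comm]
  have hdeg := h.sum_degree
  omega

end MinimalCounterexample

end Discharging

end BipartiteMinors

namespace BipartiteMinors

open Finset
open scoped Classical

universe u

/-! ### The induction and the passage to the edge set -/

section EdgeBound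

theorem Model.mono {V W : Type*} {G G' : SimpleGraph V} {H : SimpleGraph W} (hGG' : G ≤ G')
    (h : Model G H) : Model G' H :=
  h.trans (fun t => {t}) (fun t => conn_singleton t) (fun s t hst => by simpa using hst)
    fun s t hst => ⟨s, by simp, t, by simp, hGG' hst⟩

theorem card_class_add {V : Type*} [Fintype V] (c : V → Bool) (τ : Bool) :
    (univ.filter fun x => c x = τ).card + (univ.filter fun x => c x = !τ).card =
      Fintype.card V := by
  have := card_filter_add_card_filter_not (s := (univ : Finset V)) (fun x => c x = τ)
  rw [card_univ] at this
  rw [← this]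
  congr 2
  ext x
  cases c x <;> cases τ <;> simp

theorem card_edgesIn_not {V : Type*} [Fintype V] {G : SimpleGraph V} {c : V → Bool}
    (hc : ∀ x y, G.Adj x y → c x ≠ c y) (σ : Bool) :
    (edgesIn G c (!σ) univ).card = (edgesIn G c σ univ).card := by
  refine card_bij (fun p _ => p.swap) ?_ (fun p _ q _ h => Prod.swap_injective h) ?_
  · intro p hp
    obtain ⟨-, -, h3, h4⟩ := mem_edgesIn.1 hp
    refine mem_edgesIn.2 ⟨mem_univ _, mem_univ _, ?_, h4.symm⟩
    have := hc _ _ h4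
    rw [h3] at this
    simp only [Prod.fst_swap]
    revert this
    cases c p.2 <;> cases σ <;> simp
  · intro p hp
    obtain ⟨-, -, h3, h4⟩ := mem_edgesIn.1 hp
    refine ⟨p.swap, mem_edgesIn.2 ⟨mem_univ _, mem_univ _, ?_, h4.symm⟩, p.swap_swap⟩
    have := hc _ _ h4
    rw [h3] at this
    simp only [Prod.fst_swap]
    revert this
    cases c p.2 <;> cases σ <;> simp

theorem card_edgesIn_le_sum {V : Type*} [Fintype V] (G : SimpleGraph V) (c : V → Bool)
    (σ : Bool) : (edgesIn G c σ univ).card ≤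
      ∑ b ∈ univ.filter (fun x => c x = σ), (nb G b).card := by
  rw [card_eq_sum_card_fiberwise (f := Prod.fst) (t := univ.filter fun x => c x = σ)
    fun p hp => by simpa using (mem_edgesIn.1 hp).2.2.1]
  refine sum_le_sum fun b _ => card_le_card_of_injOn Prod.snd ?_ ?_
  · intro p hp
    obtain ⟨hpE, hpb⟩ := mem_filter.1 (mem_coe.1 hp)
    exact mem_nb.2 (hpb ▸ (mem_edgesIn.1 hpE).2.2.2)
  · intro p hp q hq h
    exact Prod.ext ((mem_filter.1 hp).2.trans (mem_filter.1 hq).2.symm) h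

/-- A dense two-coloured graph with a colour class of size four. -/
theorem model_of_class_four {V : Type*} [Fintype V] {G : SimpleGraph V} {c : V → Bool}
    (hc : ∀ x y, G.Adj x y → c x ≠ c y) {τ : Bool} (hτ : (univ.filter fun x => c x = τ).card = 4)
    (hτ' : 4 ≤ (univ.filter fun x => c x = !τ).card)
    (hE : 3 * Fintype.card V ≤ (edgesIn G c (!τ) univ).card + 9) : Model G K44Minus := by
  set L := univ.filter fun x => c x = τ with hL
  set B := univ.filter fun x => c x = !τ with hB
  have hn : L.card + B.card = Fintype.card V := card_class_add c τ
  have hsum := card_edgesIn_le_sum G c (!τ)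
  rw [← hB] at hsum
  have hBτ : ∀ b ∈ B, c b = !τ := fun b hb => (mem_filter.1 hb).2
  have hnbL : ∀ b ∈ B, nb G b ⊆ L := by
    intro b hb l hl
    have := hc _ _ (mem_nb.1 hl)
    rw [hBτ b hb] at this
    refine mem_filter.2 ⟨mem_univ _, ?_⟩
    revert this
    cases c l <;> cases τ <;> simp
  have hle : ∀ b ∈ B, (nb G b).card ≤ 4 := fun b hb => hτ ▸ card_le_card (hnbL b hb)
  -- At least 3|B|+3 edges leave `B` and no vertex of `B` has degree above four, so three vertices
  -- have degree four. A fourth has degree at least three, as otherwise there would be at most 12 +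
  -- 2(|B|-3) edges, too few for |B| ≥ 4.
  obtain ⟨F, hF, hF3⟩ := exists_subset_card_eq (s := B.filter fun b => (nb G b).card = 4) (n := 3)
    (by
      have h1 : ∑ b ∈ B, (nb G b).card ≤ ∑ b ∈ B, (3 + if (nb G b).card = 4 then 1 else 0) := by
        refine sum_le_sum fun b hb => ?_
        have := hle b hb
        split_ifs <;> omega
      rw [sum_add_distrib, sum_const, smul_eq_mul, ← card_filter] at h1
      omega)
  have hFB : F ⊆ B := hF.trans (filter_subset _ _)
  obtain ⟨b, hb, hb3⟩ : ∃ b ∈ B \ F, 3 ≤ (nb G b).card := by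
    by_contra hno
    push Not at hno
    have h1 := sum_sdiff (f := fun b => (nb G b).card) hFB
    have h2 : ∑ b ∈ B \ F, (nb G b).card ≤ (B \ F).card * 2 :=
      sum_le_card_nsmul _ _ _ fun b hb => by have := hno b hb; omega
    have h3 : ∑ b ∈ F, (nb G b).card ≤ F.card * 4 :=
      sum_le_card_nsmul _ _ _ fun b hb => hle b (hFB hb)
    have h4 := card_sdiff_add_card_eq_card hFB
    omega
  obtain ⟨hbB, hbF⟩ := mem_sdiff.1 hb
  have hBL : ∀ x ∈ B, x ∉ L := by
    intro x hx hxL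
    have h1 := hBτ x hx
    rw [(mem_filter.1 hxL).2] at h1
    cases τ <;> simp at h1
  obtain ⟨x, y, z, hxy, hxz, hyz, hFe⟩ := card_eq_three.1 hF3
  have hadj : ∀ w ∈ F, ∀ l ∈ L, G.Adj w l := by
    intro w hw l hl
    have h1 := mem_filter.1 (hF hw)
    have h2 := eq_of_subset_of_card_le (hnbL w h1.1) (by omega)
    exact mem_nb.1 (h2 ▸ hl)
  have hxF : x ∈ F := by simp [hFe]
  have hyF : y ∈ F := by simp [hFe]
  have hzF : z ∈ F := by simp [hFe]
  have hne : ∀ w ∈ F, w ≠ b := fun w hw h => hbF (h ▸ hw)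
  have hfull : ∀ w ∈ F, 4 ≤ (L.filter (Touches G {w})).card := by
    intro w hw
    rw [filter_true_of_mem fun l hl => by simpa using hadj w hw l hl]
    exact hτ.ge
  refine model_K44Minus_of_rows (v := x) (X₁ := {y}) (X₂ := {z}) (X₃ := {b}) hτ (hadj x hxF)
    (conn_singleton _) (conn_singleton _) (conn_singleton _) (by simpa using hxy)
    (by simpa using hxz) (by simpa using hne x hxF) (by simpa using hyz)
    (by simpa using hne y hyF) (by simpa using hne z hzF)
    (by simpa using hBL y (hFB hyF)) (by simpa using hBL z (hFB hzF)) (by simpa using hBL b hbB)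
    (hfull y hyF) (hfull z hzF) (hb3.trans (card_le_card fun l hl => ?_))
  exact mem_filter.2 ⟨hnbL b hbB hl, by simpa using hl⟩

/-- The bound on the number of edges, for graphs on `V` with two large colour classes. -/
def EdgeBound (V : Type u) [Fintype V] : Prop :=
  ∀ (G : SimpleGraph V) (c : V → Bool), (∀ x y, G.Adj x y → c x ≠ c y) →
    ¬ Model G K44Minus → ¬ Model G K6 → (∀ τ, 4 ≤ (univ.filter fun x => c x = τ).card) →
    ∀ σ, (edgesIn G c σ univ).card + 10 ≤ 3 * Fintype.card V

variable {V : Type u}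

/-- The edge bound for a minor of `G` whose vertices are represented by the elements of `T`. -/
theorem EdgeBound.card_le {T : Finset V} (hT : EdgeBound T) {G : SimpleGraph V} {c : V → Bool}
    (h44 : ¬ Model G K44Minus) (h6 : ¬ Model G K6) {σ : Bool} {E : Finset (V × V)}
    {β : V → Finset V} (hparts : ∀ τ, 4 ≤ (T.filter fun x => c x = τ).card)
    (hE : ∀ p ∈ E, p.1 ∈ T ∧ p.2 ∈ T ∧ c p.1 = σ ∧ c p.2 = !σ ∧
      ∃ x ∈ β p.1, ∃ y ∈ β p.2, G.Adj x y)
    (hβ : ∀ t ∈ T, Conn G (β t)) (hd : ∀ s ∈ T, ∀ t ∈ T, s ≠ t → Disjoint (β s) (β t)) :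
    E.card + 10 ≤ 3 * T.card := by
  let G' : SimpleGraph T := SimpleGraph.fromRel fun s t => ((s : V), (t : V)) ∈ E
  have hmodel : ∀ {W : Type} {H : SimpleGraph W}, Model G' H → Model G H := by
    intro W H h
    refine h.trans (fun t => β t) (fun t => hβ t t.2)
      (fun s t hst => hd s s.2 t t.2 fun h => hst (Subtype.ext h)) ?_
    rintro s t ⟨-, hst | hst⟩
    · exact (hE _ hst).2.2.2.2
    · obtain ⟨x, hx, y, hy, hxy⟩ := (hE _ hst).2.2.2.2
      exact ⟨y, hy, x, hx, hxy.symm⟩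
  have hcol : ∀ p ∈ E, c p.1 ≠ c p.2 := by
    intro p hp h
    obtain ⟨-, -, h1, h2, -⟩ := hE p hp
    rw [h1, h2] at h
    cases σ <;> simp at h
  have key := hT G' (fun t => c t) ?_ (fun h => h44 (hmodel h)) (fun h => h6 (hmodel h)) ?_ σ
  · rw [Fintype.card_coe] at key
    refine le_trans (Nat.add_le_add_right ?_ 10) key
    have hsub : E ⊆ (edgesIn G' (fun t => c t) σ univ).image fun p => ((p.1 : V), (p.2 : V)) := by
      intro p hp
      obtain ⟨h1, h2, h3, -, -⟩ := hE p hp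
      refine mem_image.2 ⟨(⟨p.1, h1⟩, ⟨p.2, h2⟩), mem_edgesIn.2 ⟨mem_univ _, mem_univ _, h3, ?_⟩,
        rfl⟩
      exact ⟨fun h => hcol p hp (congrArg c (congrArg Subtype.val h)), Or.inl hp⟩
    exact (card_le_card hsub).trans card_image_le
  · rintro s t ⟨-, hst | hst⟩
    · exact hcol _ hst
    · exact (hcol _ hst).symm
  · intro τ
    refine (hparts τ).trans ((card_le_card fun x hx => ?_).trans
      (card_image_le (s := univ.filter fun t : T => c t = τ) (f := Subtype.val)))
    obtain ⟨hxT, hxτ⟩ := mem_filter.1 hx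
    exact mem_image.2 ⟨⟨x, hxT⟩, mem_filter.2 ⟨mem_univ _, hxτ⟩, rfl⟩

variable [Fintype V]

/-- Deleting surplus edges gives exactly 3n-9, which makes every reduction count sharp. A class of
size four is excluded by `model_of_class_four`. With both classes of size at least five, deleting a
vertex stays within the induction hypothesis, and a vertex of degree at most three would leave too
many edges. -/
theorem edgeBound_of_forall_lt (ih : ∀ T : Finset V, T.card < Fintype.card V → EdgeBound T) :
    EdgeBound V := by
  intro G₀ c hc₀ h44₀ h6₀ hparts σ
  by_contra hlt
  have hV := card_class_add c σ
  have h4σ := hparts σ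
  have h4σ' := hparts (!σ)
  obtain ⟨E, hE, hEcard⟩ := exists_subset_card_eq (s := edgesIn G₀ c σ univ)
    (n := 3 * Fintype.card V - 9) (by omega)
  let G : SimpleGraph V := SimpleGraph.fromRel fun x y => (x, y) ∈ E
  have hGG₀ : G ≤ G₀ := by
    rintro x y ⟨-, hxy | hxy⟩
    · exact (mem_edgesIn.1 (hE hxy)).2.2.2
    · exact (mem_edgesIn.1 (hE hxy)).2.2.2.symm
  have hc : ∀ x y, G.Adj x y → c x ≠ c y := fun x y hxy => hc₀ x y (hGG₀ hxy)
  have h44 : ¬ Model G K44Minus := fun h => h44₀ (h.mono hGG₀)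
  have h6 : ¬ Model G K6 := fun h => h6₀ (h.mono hGG₀)
  have hGE : edgesIn G c σ univ = E := by
    ext p
    rw [mem_edgesIn]
    constructor
    · rintro ⟨-, -, h1, h2, h | h⟩
      · exact h
      · have h3 := mem_edgesIn.1 (hE h)
        exact absurd (h1.trans h3.2.2.1.symm) (hc₀ _ _ h3.2.2.2).symm
    · intro hp
      have h3 := mem_edgesIn.1 (hE hp)
      exact ⟨mem_univ _, mem_univ _, h3.2.2.1, h3.2.2.2.ne, Or.inl hp⟩
  have hσ : (edgesIn G c σ univ).card + 9 = 3 * Fintype.card V := by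
    rw [hGE]
    omega
  have hedges : ∀ τ, (edgesIn G c τ univ).card + 9 = 3 * Fintype.card V := by
    intro τ
    rcases Bool.eq_or_eq_not τ σ with rfl | rfl
    · exact hσ
    · rw [card_edgesIn_not hc, hσ]
  have hparts5 : ∀ τ, 5 ≤ (univ.filter fun x => c x = τ).card := by
    intro τ
    by_contra h5
    have := hparts τ
    exact h44 (model_of_class_four hc (by omega : (univ.filter fun x => c x = τ).card = 4)
      (hparts _) (hedges _).ge)
  refine MinimalCounterexample.false (G := G) (c := c)
    ⟨hc, h44, h6, hparts5, fun v => ?_, hedges,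
      fun σ T E β hT hp hE hβ hd => (ih T hT).card_le h44 h6 hp hE hβ hd⟩
  by_contra hdeg
  have hT : (univ.erase v).card + 1 = Fintype.card V := card_erase_add_one (mem_univ v)
  have key := (ih (univ.erase v) (by omega)).card_le (σ := c v)
    (E := edgesIn G c (c v) (univ.erase v)) (β := fun t => {t}) (c := c) h44 h6 (fun τ => ?_)
    (fun p hp => ?_) (fun t _ => conn_singleton t) (fun s _ t _ hst => by simpa using hst)
  · have hsub : edgesIn G c (c v) univ ⊆
        edgesIn G c (c v) (univ.erase v) ∪ ({v} : Finset V) ×ˢ nb G v := by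
      intro p hp
      obtain ⟨-, -, h3, h4⟩ := mem_edgesIn.1 hp
      by_cases hpv : p.1 = v
      · exact mem_union_right _ (mem_product.2 ⟨mem_singleton.2 hpv, mem_nb.2 (hpv ▸ h4)⟩)
      · refine mem_union_left _ (mem_edgesIn.2 ⟨by simpa using hpv, ?_, h3, h4⟩)
        refine mem_erase.2 ⟨fun h => hc _ _ h4 ?_, mem_univ _⟩
        rw [h3, h]
    have h1 := (card_le_card hsub).trans (card_union_le _ _)
    rw [card_product, card_singleton, one_mul] at h1
    have h2 := hedges (c v)
    omega
  · have h1 := hparts5 τ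
    have h2 : (univ.filter fun x => c x = τ).erase v ⊆
        (univ.erase v).filter fun x => c x = τ := fun x hx => by
      simpa using hx
    have h3 := (pred_card_le_card_erase (a := v)).trans (card_le_card h2)
    omega
  · obtain ⟨h1, h2, h3, h4⟩ := mem_edgesIn.1 hp
    refine ⟨h1, h2, h3, ?_, p.1, by simp, p.2, by simp, h4⟩
    have := hc _ _ h4
    rw [h3] at this
    revert this
    cases c p.2 <;> cases c v <;> simp

theorem edgeBound (n : ℕ) : ∀ (V : Type u) [Fintype V], Fintype.card V = n → EdgeBound V := by
  induction n using Nat.strong_induction_on with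
  | _ n ih =>
    intro V _ hV
    exact edgeBound_of_forall_lt fun T hT => ih T.card (hV ▸ hT) T (Fintype.card_coe T)

theorem ncard_edgeSet {G : SimpleGraph V} {c : V → Bool} (hc : ∀ x y, G.Adj x y → c x ≠ c y)
    (σ : Bool) : G.edgeSet.ncard = (edgesIn G c σ univ).card := by
  have himage : G.edgeSet =
      ((edgesIn G c σ univ).image fun p => s(p.1, p.2) : Finset (Sym2 V)) := by
    ext e
    induction e using Sym2.ind with
    | _ x y =>
      simp only [SimpleGraph.mem_edgeSet, coe_image, Set.mem_image, mem_coe, mem_edgesIn, mem_univ,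
        true_and, Prod.exists]
      constructor
      · intro hxy
        by_cases hx : c x = σ
        · exact ⟨x, y, ⟨hx, hxy⟩, rfl⟩
        · refine ⟨y, x, ⟨?_, hxy.symm⟩, Sym2.eq_swap⟩
          have := hc _ _ hxy
          revert this hx
          cases c x <;> cases c y <;> cases σ <;> simp
      · rintro ⟨a, b, ⟨-, hab⟩, he⟩
        rw [← SimpleGraph.mem_edgeSet, ← he]
        exact hab
  rw [himage, Set.ncard_coe_finset, card_image_of_injOn]
  intro p hp q hq hpq
  rw [mem_coe, mem_edgesIn] at hp hq
  rcases Sym2.eq_iff.1 hpq with h | h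
  · exact Prod.ext h.1 h.2
  · exact absurd (h.1 ▸ hp.2.2.1.trans hq.2.2.1.symm) (hc _ _ hq.2.2.2).symm

theorem edgesIn_subset {G : SimpleGraph V} {c : V → Bool} (hc : ∀ x y, G.Adj x y → c x ≠ c y)
    (σ : Bool) : edgesIn G c σ univ ⊆
      (univ.filter fun x => c x = σ) ×ˢ (univ.filter fun x => c x = !σ) := by
  intro p hp
  obtain ⟨-, -, h3, h4⟩ := mem_edgesIn.1 hp
  refine mem_product.2 ⟨mem_filter.2 ⟨mem_univ _, h3⟩, mem_filter.2 ⟨mem_univ _, ?_⟩⟩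
  have := hc _ _ h4
  rw [h3] at this
  revert this
  cases c p.2 <;> cases σ <;> simp

theorem nonempty_iso_completeBipartiteGraph {G : SimpleGraph V} {c : V → Bool}
    (hc : ∀ x y, G.Adj x y → c x ≠ c y) {σ : Bool} {m n : ℕ}
    (hm : (univ.filter fun x => c x = σ).card = m)
    (hn : (univ.filter fun x => c x = !σ).card = n)
    (hE : m * n ≤ (edgesIn G c σ univ).card) :
    Nonempty (G ≃g completeBipartiteGraph (Fin m) (Fin n)) := by
  have hall := eq_of_subset_of_card_le (edgesIn_subset hc σ)
    (by rw [card_product, hm, hn]; exact hE)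
  have hadj : ∀ x y, c x = σ → c y ≠ σ → G.Adj x y := by
    intro x y hx hy
    have : (x, y) ∈ edgesIn G c σ univ := by
      rw [hall]
      simp only [mem_product, mem_filter, mem_univ, true_and, hx]
      revert hy
      cases c y <;> cases σ <;> simp
    exact (mem_edgesIn.1 this).2.2.2
  have hm' : Fintype.card {x // c x = σ} = m := by rw [Fintype.card_subtype, hm]
  have hn' : Fintype.card {x // ¬ c x = σ} = n := by
    rw [Fintype.card_subtype, ← hn]
    congr 1
    ext x
    cases c x <;> cases σ <;> simp
  let e : V ≃ Fin m ⊕ Fin n := (Equiv.sumCompl fun x => c x = σ).symm.trans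
    (Equiv.sumCongr (Fintype.equivFinOfCardEq hm') (Fintype.equivFinOfCardEq hn'))
  have he : ∀ x, ((e x).isLeft = true ↔ c x = σ) ∧ ((e x).isRight = true ↔ c x ≠ σ) := by
    intro x
    by_cases hx : c x = σ
    · simp [e, hx]
    · simp [e, hx]
  refine ⟨⟨e, fun {x y} => ?_⟩⟩
  rw [completeBipartiteGraph_adj, (he x).1, (he x).2, (he y).1, (he y).2]
  constructor
  · rintro (h | h)
    · exact hadj x y h.1 h.2
    · exact (hadj y x h.2 h.1).symm
  · intro hxy
    have := hc _ _ hxy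
    by_cases hx : c x = σ
    · exact Or.inl ⟨hx, fun h => this (hx.trans h.symm)⟩
    · refine Or.inr ⟨hx, ?_⟩
      revert this hx
      cases c x <;> cases c y <;> cases σ <;> simp

/-- The edge bound for two-coloured graphs, without restriction on the colour classes. -/
theorem card_edgesIn_le {G : SimpleGraph V} {c : V → Bool} (hc : ∀ x y, G.Adj x y → c x ≠ c y)
    (hV : 5 ≤ Fintype.card V) (h44 : ¬ Model G K44Minus) (h6 : ¬ Model G K6)
    (hiso : ¬ Nonempty (G ≃g completeBipartiteGraph (Fin 3) (Fin (Fintype.card V - 3)))) :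
    (edgesIn G c true univ).card + 10 ≤ 3 * Fintype.card V := by
  by_cases hparts : ∀ τ, 4 ≤ (univ.filter fun x => c x = τ).card
  · exact edgeBound _ V rfl G c hc h44 h6 hparts true
  push Not at hparts
  obtain ⟨σ, hσ⟩ := hparts
  have hE : ∀ τ, (edgesIn G c τ univ).card = (edgesIn G c true univ).card := fun τ => by
    rw [← ncard_edgeSet hc, ← ncard_edgeSet hc]
  -- With a class of size three, exceeding the bound means having all 3(n-3) possible edges.
  have hthree : ∀ τ, (univ.filter fun x => c x = τ).card = 3 →
      (edgesIn G c true univ).card + 10 ≤ 3 * Fintype.card V := by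
    intro τ hτ
    have h1 := card_class_add c τ
    by_contra hlt
    refine hiso (nonempty_iso_completeBipartiteGraph hc hτ (by omega) ?_)
    rw [hE τ]
    omega
  have h1 := card_class_add c σ
  have h2 := card_le_card (edgesIn_subset hc σ)
  rw [card_product, hE σ] at h2
  generalize hp : (univ.filter fun x => c x = σ).card = p at *
  by_cases hq : (univ.filter fun x => c x = !σ).card = 3
  · exact hthree _ hq
  · by_cases hp3 : p = 3
    · exact hthree σ (hp.trans hp3)
    -- For p ≤ 2 one has p(n-p) ≤ 3n-10, except for p = 2 and n = 5; there the other class has size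
    -- three, which was treated above.
    · interval_cases p <;> omega

end EdgeBound

end BipartiteMinors

theorem theorem3p1 {V : Type*} [Fintype V] (G : SimpleGraph V)
    (hn : 5 ≤ Fintype.card V)
    (hbip : G.IsBipartite)
    (hK6 : ¬ BipartiteMinors.HasMinor G BipartiteMinors.K6)
    (hK133 : ¬ BipartiteMinors.HasMinor G BipartiteMinors.K133)
    (hK44 : ¬ BipartiteMinors.HasMinor G BipartiteMinors.K44Minus)
    (hK6DY : ¬ BipartiteMinors.HasMinor G BipartiteMinors.K6DeltaY)
    (hK3 : ¬ Nonempty (G ≃g completeBipartiteGraph (Fin 3) (Fin (Fintype.card V - 3)))) :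
    (G.edgeSet.ncard : ℤ) ≤ 3 * (Fintype.card V : ℤ) - 10 := by
  obtain ⟨C⟩ := hbip
  have hc : ∀ x y, G.Adj x y → decide (C x = 0) ≠ decide (C y = 0) := by
    intro x y hxy h
    have hne := C.valid hxy
    rw [decide_eq_decide] at h
    omega
  have h1 := BipartiteMinors.card_edgesIn_le hc hn (fun h => hK44 h.hasMinor)
    (fun h => hK6 h.hasMinor) hK3
  rw [BipartiteMinors.ncard_edgeSet hc true]
  omega
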